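/- **Setting.** Let $\mathcal X$ be a measurable space and let $n, B \in \mathbb{N}$ with $B \ge 1$ and $n \ge 2B$; let $\delta > 0$. Let $g : \mathcal X \to [0,1]$ be measurable and let $P$ be a probability distribution on $\mathcal X \times [0,1]$. Let $\mathcal D_n = ((X_i,Y_i))_{i\le n}$ be i.i.d. from $P$, with an independent test pair $(X,Y)\sim P$; let $U_1,\dots,U_n,V_1,\dots,V_B,U$ be i.i.d. uniform on $[0,1]$ and independent of the data and the test pair. **Randomized UMD** (uniform-mass binning with double dipping, $B$ bins, randomization parameter $\delta$). Put $S_i = (1+\delta)^{-1}(g(X_i)+\delta U_i)$, with order statistics $S_{(1)}\le\dots\le S_{(n)}$ and $S_{(0)}=0$, $S_{(n+1)}=1$; let $Y_{(1)},\dots,Y_{(n)}$ be the labels arranged in the order of the scores. Put $A_b = \lceil b(n+1)/B\rceil$ for $0 \le b \le B$. For $1\le b\le B$ let $\widehat\Pi_b = (1+\delta)^{-1}\big(\mathrm{Mean}(Y_{(A_{b-1}+1)},\dots,Y_{(A_b-1)}) + \delta V_b\big)$. The output is the randomized predictor $$h(X)=h(X,U)=\sum_{b=1}^B \mathbf 1\{S_{(A_{b-1})}\le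 (1+\delta)^{-1}(g(X)+\delta U)<S_{(A_b)}\}\,\widehat\Pi_b .$$ **Calibration.** In the following, $\mathbb E[Y\mid h(X)]$, $\mathbb{E}[Y \mid h(X)=r]$ and $\ell_p\text{-ECE}(h) = (\mathbb E|\mathbb E[Y\mid h(X)]-h(X)|^p)^{1/p}$ are taken over the test point $(X,Y,U)$ for fixed $h$, that is, for fixed $\mathcal D_n$, $U_i$, $V_b$. A randomized calibrator is $(\varepsilon,\alpha)$-marginally calibrated if for all $g$ and $P$, $\Pr(|\mathbb E[Y\mid h(X)]-h(X)|\le\varepsilon)\ge 1-\alpha$, the probability being over the calibration data, the randomization of the calibrator and the test point. It is $(\varepsilon,\alpha)$-conditionally calibrated if for all $g$ and $P$, with probability at least $1-\alpha$ over the calibration data and the randomization of the calibrator, $|\mathbb E[Y\mid h(X)=r]-r|\le\varepsilon$ for every $r\in\mathrm{Range}(h)$ (excluding values $r$ that $h(X)$ takes with probability zero, where the conditional expectation is undefined). **Theorem.** For every $\alpha\in(0,1)$, randomized UMD is $(\varepsilon_1,\alpha)$-marginally calibrated and $(\varepsilon_2,\alpha)$-conditionally calibrated, where $$\varepsilon_1=\sqrt{\frac{\log(2/\alpha)}{2(\lfloor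 n/B\rfloor-1)}}+\delta,\qquad \varepsilon_2=\sqrt{\frac{\log(2B/\alpha)}{2(\lfloor n/B\rfloor-1)}}+\delta .$$ Further, for every $g$ and $P$ as above: (a) for every $\alpha \in (0,1)$, with probability at least $1-\alpha$ over $\mathcal D_n$, $U_1,\dots,U_n$, $V_1,\dots,V_B$, one has $\ell_p\text{-ECE}(h)\le\varepsilon_2$ simultaneously for all $p\in[1,\infty)$; (b) for all $p\in[1,2]$, $\mathbb E[\ell_p\text{-ECE}(h)]\le\sqrt{B/(2n)}+\delta$, the expectation being over $\mathcal D_n$, $U_1,\dots,U_n$, $V_1,\dots,V_B$. -/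

import Mathlib

open MeasureTheory ProbabilityTheory Set
open scoped unitInterval

noncomputable section

namespace RandomizedUMD

/-! ### Calibration of predictors

The feature space is `𝒳`, labels and scores live in `I = [0, 1]`, and `P` is the joint law of
`(X, Y)` on `𝒳 × I`. A randomized predictor is a function `h : 𝒳 × I → ℝ`: its prediction for `X` is
`h (X, U)`, where `U` is uniform on `[0, 1]` and independent of `(X, Y)`. -/

section Calibration

variable {𝒳 : Type*} [MeasurableSpace 𝒳]

/-- The law of an independent test triple `((X, Y), U)`: `(X, Y) ∼ P` and `U ∼ Unif[0, 1]`. -/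
def testLaw (P : Measure (𝒳 × I)) : Measure ((𝒳 × I) × I) :=
  P.prod (volume : Measure I)

instance (P : Measure (𝒳 × I)) [IsProbabilityMeasure P] : IsProbabilityMeasure (testLaw P) := by
  unfold testLaw; infer_instance

/-- The label `Y` of a test triple. -/
def label (ω : (𝒳 × I) × I) : I := ω.1.2

/-- The prediction `h (X, U)` on a test triple. -/
def prediction (h : 𝒳 × I → ℝ) (ω : (𝒳 × I) × I) : ℝ := h (ω.1.1, ω.2)

/-- The regression function `r ↦ E[Y ∣ h(X) = r]`, for a fixed predictor `h`. -/
def condMean (P : Measure (𝒳 × I)) [IsProbabilityMeasure P] (h : 𝒳 × I → ℝ) (r : ℝ) : ℝ :=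
  ∫ y, (y : ℝ) ∂(condDistrib label (prediction h) (testLaw P) r)

/-- The property `∀ r ∈ Range(h), |E[Y ∣ h(X) = r] - r| ≤ ε`. As `E[Y ∣ h(X) = r]` is determined
only up to null sets of the law of `h(X)`, "every `r`" means almost every `r` for that law; if `h`
has countable range this is every `r` in the range with `Pr(h(X) = r) > 0`
(see `uniformlyCalibrated_iff`). -/
def UniformlyCalibrated (P : Measure (𝒳 × I)) [IsProbabilityMeasure P] (h : 𝒳 × I → ℝ)
    (ε : ℝ) : Prop :=
  ∀ᵐ r ∂((testLaw P).map (prediction h)), |condMean P h r - r| ≤ ε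

theorem uniformlyCalibrated_iff (P : Measure (𝒳 × I)) [IsProbabilityMeasure P]
    (h : 𝒳 × I → ℝ) (hm : Measurable h) (hc : (range h).Countable) (ε : ℝ) :
    UniformlyCalibrated P h ε ↔
      ∀ r ∈ range h, testLaw P {ω | prediction h ω = r} ≠ 0 → |condMean P h r - r| ≤ ε := by
  have hp : Measurable (prediction h) := by unfold prediction; fun_prop
  have key : ∀ r, (testLaw P).map (prediction h) {r} = testLaw P {ω | prediction h ω = r} :=
    fun r => Measure.map_apply hp (measurableSet_singleton r)
  unfold UniformlyCalibrated
  constructor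
  · intro H r _ h0
    by_contra hr
    apply h0
    rw [← key]
    exact measure_mono_null (by simpa using hr) (ae_iff.1 H)
  · intro H
    have h1 : ∀ᵐ r ∂((testLaw P).map (prediction h)), r ∈ range h := by
      exact (ae_map_iff hp.aemeasurable hc.measurableSet).2 (ae_of_all _ fun ω => mem_range_self _)
    have h2 : ∀ᵐ r ∂((testLaw P).map (prediction h)), ∀ s ∈ range h,
        testLaw P {ω | prediction h ω = s} = 0 → r ≠ s := by
      rw [ae_ball_iff hc]
      intro s _
      by_cases h0 : testLaw P {ω | prediction h ω = s} = 0
      · rw [← key] at h0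
        filter_upwards [compl_mem_ae_iff.2 h0] with r hr _
        exact hr
      · simp [h0]
    filter_upwards [h1, h2] with r hr hs
    exact H r hr fun h0 => hs r hr h0 rfl

/-- The `ℓ_p`-expected calibration error of a fixed predictor `h`,
`(E |E[Y ∣ h(X)] - h(X)|^p)^(1/p)`. -/
def ece (P : Measure (𝒳 × I)) [IsProbabilityMeasure P] (h : 𝒳 × I → ℝ) (p : ℝ) : ℝ :=
  (∫ ω, |condMean P h (prediction h ω) - prediction h ω| ^ p ∂(testLaw P)) ^ (1 / p)

/-! ### Calibrators

A randomized calibrator `H` maps a predictor `g : 𝒳 → I`, calibration data `D`, and a seed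
`θ ∼ ν` that is independent of everything else, to a randomized predictor `H g D θ`. -/

variable {n : ℕ} {Θ : Type*} [MeasurableSpace Θ]

/-- The law of the calibration data (`n` independent draws from `P`) and of the seed. -/
def trainLaw (n : ℕ) (P : Measure (𝒳 × I)) (ν : Measure Θ) :
    Measure ((Fin n → 𝒳 × I) × Θ) :=
  (Measure.pi fun _ => P).prod ν

/-- `(ε, α)`-marginal calibration: for all `g` and `P`, the inequality
`|E[Y ∣ h(X)] - h(X)| ≤ ε` fails with probability at most `α`, over the calibration data, the seed
and the test point. -/
def MarginallyCalibrated (ν : Measure Θ)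
    (H : (𝒳 → I) → (Fin n → 𝒳 × I) → Θ → 𝒳 × I → ℝ) (ε α : ℝ) : Prop :=
  ∀ g : 𝒳 → I, Measurable g → ∀ (P : Measure (𝒳 × I)) [IsProbabilityMeasure P],
    ((trainLaw n P ν).prod (testLaw P))
      {τ | |condMean P (H g τ.1.1 τ.1.2) (prediction (H g τ.1.1 τ.1.2) τ.2)
          - prediction (H g τ.1.1 τ.1.2) τ.2| ≤ ε}ᶜ ≤ ENNReal.ofReal α

/-- `(ε, α)`-conditional calibration: for all `g` and `P`, the property
`∀ r ∈ Range(h), |E[Y ∣ h(X) = r] - r| ≤ ε` fails with probability at most `α`, over the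
calibration data and the seed. -/
def ConditionallyCalibrated (ν : Measure Θ)
    (H : (𝒳 → I) → (Fin n → 𝒳 × I) → Θ → 𝒳 × I → ℝ) (ε α : ℝ) : Prop :=
  ∀ g : 𝒳 → I, Measurable g → ∀ (P : Measure (𝒳 × I)) [IsProbabilityMeasure P],
    trainLaw n P ν {τ | UniformlyCalibrated P (H g τ.1 τ.2) ε}ᶜ ≤ ENNReal.ofReal α

end Calibration

/-! ### The algorithm -/

section Algorithm

variable {𝒳 : Type*} {n : ℕ}

/-- The order statistics `S_(1) ≤ … ≤ S_(n)`, with `S_(0) = 0` and `S_(n+1) = 1`. -/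
def orderStat (S : Fin n → ℝ) (k : ℕ) : ℝ :=
  if k = 0 then 0 else if hk : k - 1 < n then S (Tuple.sort S ⟨k - 1, hk⟩) else 1

/-- `Y_(1), …, Y_(n)`: the labels arranged in the order of the scores `S`
(only indices in `1, …, n` are ever used). -/
def orderedLabel (S Y : Fin n → ℝ) (k : ℕ) : ℝ :=
  if hk : k - 1 < n then Y (Tuple.sort S ⟨k - 1, hk⟩) else 0

/-- The boundary index `A_b = ⌈b Δ⌉`, with `Δ = (n + 1) / B`. -/
def boundary (n B b : ℕ) : ℕ := ⌈(b : ℝ) * (((n : ℝ) + 1) / (B : ℝ))⌉₊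

/-- The mean of `Y_(l+1), …, Y_(u-1)`, for `l = A_b` and `u = A_(b+1)`
(bins are numbered from `0`). -/
def binMean (B : ℕ) (S Y : Fin n → ℝ) (b : ℕ) : ℝ :=
  (∑ k ∈ Finset.Ioo (boundary n B b) (boundary n B (b + 1)), orderedLabel S Y k) /
    ((Finset.Ioo (boundary n B b) (boundary n B (b + 1))).card : ℝ)

/-- The perturbation `(1 + δ)⁻¹ (t + δ u)`. -/
def perturb (δ t u : ℝ) : ℝ := (1 + δ)⁻¹ * (t + δ * u)

/-- The seed of the algorithm: `U_1, …, U_n` and `V_1, …, V_B`. -/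
abbrev Seed (n B : ℕ) : Type := (Fin n → I) × (Fin B → I)

/-- All seed variables are independent and uniform on `[0, 1]`. -/
def seedLaw (n B : ℕ) : Measure (Seed n B) :=
  (Measure.pi fun _ => (volume : Measure I)).prod (Measure.pi fun _ => (volume : Measure I))

/-- The perturbed scores `S_i = (1 + δ)⁻¹ (g(X_i) + δ U_i)`. -/
def scores (δ : ℝ) (g : 𝒳 → I) (D : Fin n → 𝒳 × I) (U : Fin n → I) (i : Fin n) : ℝ :=
  perturb δ (g (D i).1) (U i)

open Classical in
/-- Randomized UMD (uniform-mass binning with double dipping), with `B` bins and randomization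
parameter `δ`: the output at the feature `z.1`, with test-time noise `z.2`. -/
def umd (B : ℕ) (δ : ℝ) (g : 𝒳 → I) (D : Fin n → 𝒳 × I) (θ : Seed n B) (z : 𝒳 × I) : ℝ :=
  ∑ b : Fin B,
    if orderStat (scores δ g D θ.1) (boundary n B b) ≤ perturb δ (g z.1) z.2 ∧
        perturb δ (g z.1) z.2 < orderStat (scores δ g D θ.1) (boundary n B (b + 1))
    then perturb δ (binMean B (scores δ g D θ.1) (fun i => ((D i).2 : ℝ)) b) (θ.2 b)
    else 0

end Algorithm

end RandomizedUMD

end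

/-! The same data fix the bins and estimate the bin means, yet the two uses hardly interact. The
noise `U` makes the law of the perturbed score atomless, so almost surely there are no ties
(`NoTies`). Fix which indices `M` fall strictly inside a bin, and fix the points outside `M`. The
two boundary scores are then determined, and the points in `M` range over a product set: up to null
sets, each one only has to land between the boundaries. Hence, given its boundaries, a bin holds
independent draws from the test law conditioned on the bin (`lintegral_resample`), so Hoeffding's
inequality and the variance bound apply to the bin mean. A bin contains `binCount n B b ≥ ⌊n/B⌋ - 1`
points.

The noise `V` makes the values of the bins almost surely distinct (`ae_injective_binValue`). So `E[Y
∣ h(X)]` on a bin of positive mass is the mean label there (`condMean_of_partition`), and the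
perturbation of the bin mean costs at most `δ`.

Conditional calibration is a union bound over the `B` bins. For marginal calibration each deviation
is weighted by the mass of its bin. The resampling bound allows such a weight because the mass
depends only on the boundaries. By exchangeability the mass of bin `b` has mean at most `(A_{b+1} -
A_b)/(n+1)` (`lintegral_mass_le`), and these bounds sum to `1`, so no factor `B` appears in the
logarithm.

The high-probability ECE bound holds on the event of conditional calibration, for all `p` at once.
For the expectation, a bin with `N` points contributes at most `1/(4N) · (N+1)/(n+1) ≤ 1/(2n)` to
the mass-weighted square error. Summation over bins, Minkowski's inequality and concavity of the
square root finish the proof. -/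

noncomputable section

namespace RandomizedUMD

/-! ### Order statistics and the indices inside a bin -/

section OrderStat
variable {n : ℕ}

theorem card_filter_comp_sort (S : Fin n → ℝ) (p : ℝ → Prop) [DecidablePred p] :
    (Finset.univ.filter fun i => p (S (Tuple.sort S i))).card =
      (Finset.univ.filter fun i => p (S i)).card :=
  Finset.card_equiv (Tuple.sort S) (by simp)

/-- Trades sorting for counting; a count does not notice scores moving on one side of the threshold.
The range of `s` is what the conventions `S_(0) = 0` and `S_(n+1) = 1` require. -/
theorem orderStat_le_iff (S : Fin n → ℝ) (k : ℕ) {s : ℝ} (h0 : 0 ≤ s) (h1 : s < 1) :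
    orderStat S k ≤ s ↔ k ≤ (Finset.univ.filter fun i => S i ≤ s).card := by
  unfold orderStat
  split_ifs with hk hn
  · simp [hk, h0]
  · have := Tuple.lt_card_le_iff_apply_le_of_monotone (f := S ∘ Tuple.sort S) (a := s)
      (j := ⟨k - 1, hn⟩) (Tuple.monotone_sort S)
    simp only [Function.comp_apply] at this
    rw [← this, card_filter_comp_sort S (· ≤ s)]
    omega
  · have : (Finset.univ.filter fun i => S i ≤ s).card ≤ n := by
      simpa using Finset.card_filter_le (Finset.univ : Finset (Fin n)) (fun i => S i ≤ s)
    constructor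
    · intro h; linarith
    · intro h; omega

theorem orderStat_lt_iff (S : Fin n → ℝ) (k : ℕ) {s : ℝ} (h0 : 0 < s) (h1 : s ≤ 1) :
    orderStat S k < s ↔ k ≤ (Finset.univ.filter fun i => S i < s).card := by
  unfold orderStat
  split_ifs with hk hn
  · simp [hk, h0]
  · have := Tuple.lt_card_lt_iff_apply_lt_of_monotone (f := S ∘ Tuple.sort S) (a := s)
      (j := ⟨k - 1, hn⟩) (Tuple.monotone_sort S)
    simp only [Function.comp_apply] at this
    rw [← this, card_filter_comp_sort S (· < s)]
    omega
  · have : (Finset.univ.filter fun i => S i < s).card ≤ n := by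
      simpa using Finset.card_filter_le (Finset.univ : Finset (Fin n)) (fun i => S i < s)
    constructor
    · intro h; linarith
    · intro h; omega

theorem orderStat_zero (S : Fin n → ℝ) : orderStat S 0 = 0 := by simp [orderStat]

theorem orderStat_succ (S : Fin n → ℝ) (j : Fin n) :
    orderStat S (j + 1) = S (Tuple.sort S j) := by
  simp [orderStat]

theorem orderStat_of_lt (S : Fin n → ℝ) {k : ℕ} (hk : n < k) : orderStat S k = 1 := by
  unfold orderStat
  rw [if_neg (by omega), dif_neg (by omega)]

theorem orderStat_nonneg {S : Fin n → ℝ} (h : ∀ i, 0 ≤ S i) (k : ℕ) : 0 ≤ orderStat S k := by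
  unfold orderStat
  split_ifs
  exacts [le_rfl, h _, zero_le_one]

theorem orderStat_le_one {S : Fin n → ℝ} (h : ∀ i, S i ≤ 1) (k : ℕ) : orderStat S k ≤ 1 := by
  unfold orderStat
  split_ifs
  exacts [zero_le_one, h _, le_rfl]

theorem orderStat_mono {S : Fin n → ℝ} (h : ∀ i, S i ∈ Icc (0 : ℝ) 1) :
    Monotone (orderStat S) := by
  intro a b hab
  rcases (orderStat_le_one (fun i => (h i).2) b).lt_or_eq with hb | hb
  · have h0 := orderStat_nonneg (fun i => (h i).1) b
    exact (orderStat_le_iff S a h0 hb).2 (hab.trans ((orderStat_le_iff S b h0 hb).1 le_rfl))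
  · rw [hb]; exact orderStat_le_one (fun i => (h i).2) a

/-- Scores in general position: no ties, and no score at an end of the unit interval. -/
def NoTies (S : Fin n → ℝ) : Prop := Function.Injective S ∧ ∀ i, S i ∈ Ioo (0 : ℝ) 1

theorem NoTies.mem_Icc {S : Fin n → ℝ} (h : NoTies S) (i : Fin n) : S i ∈ Icc (0 : ℝ) 1 :=
  Ioo_subset_Icc_self (h.2 i)

theorem NoTies.orderStat_lt_one {S : Fin n → ℝ} (h : NoTies S) {k : ℕ} (hk : k ≤ n) :
    orderStat S k < 1 := by
  unfold orderStat
  split_ifs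
  · exact zero_lt_one
  · exact (h.2 _).2
  · omega

theorem NoTies.orderStat_pos {S : Fin n → ℝ} (h : NoTies S) {k : ℕ} (hk : 0 < k) :
    0 < orderStat S k := by
  unfold orderStat
  split_ifs
  · omega
  · exact (h.2 _).1
  · exact zero_lt_one

theorem NoTies.strictMonoOn {S : Fin n → ℝ} (h : NoTies S) :
    StrictMonoOn (orderStat S) (Iic (n + 1)) := by
  intro a ha b hb hab
  simp only [mem_Iic] at ha hb
  rcases Nat.eq_zero_or_pos a with rfl | ha0
  · rw [orderStat_zero]; exact h.orderStat_pos hab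
  rcases (Nat.lt_or_ge n b) with hbn | hbn
  · rw [orderStat_of_lt S hbn]; exact h.orderStat_lt_one (by omega)
  refine lt_of_le_of_ne (orderStat_mono h.mem_Icc hab.le) ?_
  have e1 := orderStat_succ S ⟨a - 1, by omega⟩
  have e2 := orderStat_succ S ⟨b - 1, by omega⟩
  simp only [Nat.sub_add_cancel ha0, Nat.sub_add_cancel (show 1 ≤ b by omega)] at e1 e2
  rw [e1, e2]
  intro hc
  have := (Tuple.sort S).injective (h.1 hc)
  simp only [Fin.mk.injEq] at this
  omega

/-- The indices of the scores strictly between two order statistics. -/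
def inner (l u : ℕ) (S : Fin n → ℝ) : Finset (Fin n) :=
  Finset.univ.filter fun i => orderStat S l < S i ∧ S i < orderStat S u

theorem mem_inner {l u : ℕ} {S : Fin n → ℝ} {i : Fin n} :
    i ∈ inner l u S ↔ orderStat S l < S i ∧ S i < orderStat S u := by
  simp [inner]

theorem NoTies.sort_mem_inner {S : Fin n → ℝ} (h : NoTies S) {l u : ℕ} (hl : l ≤ n)
    (hu : u ≤ n + 1) (j : Fin n) : Tuple.sort S j ∈ inner l u S ↔ l < j + 1 ∧ j + 1 < u := by
  rw [mem_inner, ← orderStat_succ S j, h.strictMonoOn.lt_iff_lt, h.strictMonoOn.lt_iff_lt]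
  all_goals simp only [mem_Iic]; omega

/-- Removes the sorting permutation: once the inner indices are known, the bin sum is a plain sum of
labels over them. -/
theorem NoTies.sum_inner {S : Fin n → ℝ} (h : NoTies S) {l u : ℕ} (hl : l ≤ n)
    (hu : u ≤ n + 1) (Y : Fin n → ℝ) :
    ∑ k ∈ Finset.Ioo l u, orderedLabel S Y k = ∑ i ∈ inner l u S, Y i := by
  refine Finset.sum_bij' (fun k hk => Tuple.sort S ⟨k - 1, by
      rw [Finset.mem_Ioo] at hk; omega⟩) (fun i _ => ((Tuple.sort S).symm i : ℕ) + 1) ?_ ?_ ?_ ?_ ?_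
  · intro k hk
    rw [h.sort_mem_inner hl hu]
    rw [Finset.mem_Ioo] at hk
    simp only
    omega
  · intro i hi
    rw [← (Tuple.sort S).apply_symm_apply i, h.sort_mem_inner hl hu] at hi
    exact Finset.mem_Ioo.2 hi
  · intro k hk
    rw [Finset.mem_Ioo] at hk
    simp only [Equiv.symm_apply_apply]
    omega
  · intro i hi
    simp
  · intro k hk
    rw [Finset.mem_Ioo] at hk
    rw [orderedLabel, dif_pos (by omega)]

theorem NoTies.card_inner {S : Fin n → ℝ} (h : NoTies S) {l u : ℕ} (hl : l ≤ n)
    (hu : u ≤ n + 1) : (inner l u S).card = u - l - 1 := by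
  have h1 := h.sum_inner hl hu (fun _ => 1)
  rw [Finset.sum_congr rfl (g := fun _ => (1 : ℝ))] at h1
  · simp only [Finset.sum_const, nsmul_eq_mul, mul_one, Nat.card_Ioo] at h1
    exact_mod_cast h1.symm
  · intro k hk
    rw [Finset.mem_Ioo] at hk
    rw [orderedLabel, dif_pos (by omega)]

/-- Scores with index in `M` exceed `x` in both configurations, so the number of scores at most `x`
only sees the others. -/
theorem orderStat_le_of_agree {S S' : Fin n → ℝ} {M : Finset (Fin n)}
    (ha : ∀ i, i ∉ M → S i = S' i) {x : ℝ} (hS : ∀ i ∈ M, x < S i) (hS' : ∀ i ∈ M, x < S' i)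
    (h0 : 0 ≤ x) (h1 : x < 1) {k : ℕ} (h : orderStat S' k ≤ x) : orderStat S k ≤ x := by
  rw [orderStat_le_iff _ _ h0 h1] at h ⊢
  convert h using 2
  ext i
  by_cases hi : i ∈ M
  · simp [(hS i hi).not_ge, (hS' i hi).not_ge]
  · simp [ha i hi]

theorem orderStat_lt_of_agree {S S' : Fin n → ℝ} {M : Finset (Fin n)}
    (ha : ∀ i, i ∉ M → S i = S' i) {x : ℝ} (hS : ∀ i ∈ M, S i < x) (hS' : ∀ i ∈ M, S' i < x)
    (h0 : 0 < x) (h1 : x ≤ 1) {k : ℕ} (h : orderStat S' k < x) : orderStat S k < x := by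
  rw [orderStat_lt_iff _ _ h0 h1] at h ⊢
  convert h using 2
  ext i
  by_cases hi : i ∈ M
  · simp [hS i hi, hS' i hi]
  · simp [ha i hi]

/-- Two configurations that agree off their common set of inner indices have the same lower
boundary. -/
theorem orderStat_le_of_inner_eq {S S' : Fin n → ℝ} (h' : NoTies S')
    {M : Finset (Fin n)} (ha : ∀ i, i ∉ M → S i = S' i) {l : ℕ} (hl : l ≤ n)
    (hS : ∀ i ∈ M, orderStat S l < S i) (hS' : ∀ i ∈ M, orderStat S' l < S' i) :
    orderStat S l ≤ orderStat S' l := by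
  by_contra! hlt
  exact hlt.not_ge (orderStat_le_of_agree ha (fun i hi => hlt.trans (hS i hi)) hS'
    (orderStat_nonneg (fun i => (h'.mem_Icc i).1) l) (h'.orderStat_lt_one hl) le_rfl)

theorem orderStat_ge_of_inner_eq {S S' : Fin n → ℝ} (h : NoTies S)
    {M : Finset (Fin n)} (ha : ∀ i, i ∉ M → S i = S' i) {u : ℕ} (hu : 0 < u)
    (hS : ∀ i ∈ M, S i < orderStat S u) (hS' : ∀ i ∈ M, S' i < orderStat S' u) :
    orderStat S u ≤ orderStat S' u := by
  by_contra! hlt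
  exact lt_irrefl _ (orderStat_lt_of_agree ha hS (fun i hi => (hS' i hi).trans hlt)
    (h.orderStat_pos hu) (orderStat_le_one (fun i => (h.mem_Icc i).2) u) hlt)

/-- With the outer points held fixed, the boundaries are constant on the event that `M` is the inner
set. Together with `inner_eq_of_mem_Ioo` this makes the section of that event a product set. -/
theorem orderStat_eq_of_inner_eq {S S' : Fin n → ℝ} (h : NoTies S) (h' : NoTies S')
    {M : Finset (Fin n)} (ha : ∀ i, i ∉ M → S i = S' i) {l u : ℕ} (hl : l ≤ n) (hu : 0 < u)
    (hS : inner l u S = M) (hS' : inner l u S' = M) :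
    orderStat S' l = orderStat S l ∧ orderStat S' u = orderStat S u := by
  have a1 : ∀ i ∈ M, orderStat S l < S i ∧ S i < orderStat S u := fun i hi => by
    rwa [← hS, mem_inner] at hi
  have a2 : ∀ i ∈ M, orderStat S' l < S' i ∧ S' i < orderStat S' u := fun i hi => by
    rwa [← hS', mem_inner] at hi
  have ha' : ∀ i, i ∉ M → S' i = S i := fun i hi => (ha i hi).symm
  exact ⟨le_antisymm
      (orderStat_le_of_inner_eq h ha' hl (fun i hi => (a2 i hi).1) fun i hi => (a1 i hi).1)
      (orderStat_le_of_inner_eq h' ha hl (fun i hi => (a1 i hi).1) fun i hi => (a2 i hi).1),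
    le_antisymm
      (orderStat_ge_of_inner_eq h' ha' hu (fun i hi => (a2 i hi).2) fun i hi => (a1 i hi).2)
      (orderStat_ge_of_inner_eq h ha hu (fun i hi => (a1 i hi).2) fun i hi => (a2 i hi).2)⟩

/-- Moving the inner scores within their bin changes neither the boundaries of the bin nor its set
of inner indices. -/
theorem inner_eq_of_mem_Ioo {S S' : Fin n → ℝ} (h : NoTies S) (h' : NoTies S')
    {M : Finset (Fin n)} (ha : ∀ i, i ∉ M → S i = S' i) {l u : ℕ} (hl : l ≤ n) (hu : 0 < u)
    (hS : inner l u S = M) (hS' : ∀ i ∈ M, S' i ∈ Ioo (orderStat S l) (orderStat S u)) :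
    inner l u S' = M := by
  have a1 : ∀ i ∈ M, orderStat S l < S i ∧ S i < orderStat S u := fun i hi => by
    rwa [← hS, mem_inner] at hi
  have ha' : ∀ i, i ∉ M → S' i = S i := fun i hi => (ha i hi).symm
  have e1 : orderStat S' l = orderStat S l := by
    apply le_antisymm
    · exact orderStat_le_of_agree ha' (fun i hi => (hS' i hi).1) (fun i hi => (a1 i hi).1)
        (orderStat_nonneg (fun i => (h.mem_Icc i).1) l) (h.orderStat_lt_one hl) le_rfl
    -- A smaller new boundary would lie below the inner scores of both configurations, and counting
    -- there forces the old boundary down to it.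
    · by_contra! hlt
      exact hlt.not_ge (orderStat_le_of_agree ha (fun i hi => hlt.trans (a1 i hi).1)
        (fun i hi => hlt.trans (hS' i hi).1)
        (orderStat_nonneg (fun i => (h'.mem_Icc i).1) l) (h'.orderStat_lt_one hl) le_rfl)
  have e2 : orderStat S' u = orderStat S u := by
    apply le_antisymm
    · by_contra! hlt
      exact lt_irrefl _ (orderStat_lt_of_agree ha' (fun i hi => (hS' i hi).2.trans hlt)
        (fun i hi => (a1 i hi).2.trans hlt)
        (h'.orderStat_pos hu) (orderStat_le_one (fun i => (h'.mem_Icc i).2) u) hlt)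
    · by_contra! hlt
      exact lt_irrefl _ (orderStat_lt_of_agree ha (fun i hi => (a1 i hi).2)
        (fun i hi => (hS' i hi).2)
        (h.orderStat_pos hu) (orderStat_le_one (fun i => (h.mem_Icc i).2) u) hlt)
  ext i
  rw [mem_inner, e1, e2]
  by_cases hi : i ∈ M
  · simpa [hi] using hS' i hi
  · rw [ha' i hi, ← mem_inner, hS]

/-! ### Measurability of sorting and order statistics -/

theorem measurableSet_noTies : MeasurableSet {S : Fin n → ℝ | NoTies S} := by
  have : {S : Fin n → ℝ | NoTies S} =
      (⋂ i, ⋂ j, {S : Fin n → ℝ | S i = S j → i = j}) ∩ ⋂ i, {S | S i ∈ Ioo (0 : ℝ) 1} := by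
    ext S
    simp [NoTies, Function.Injective]
  rw [this]
  refine (MeasurableSet.iInter fun i => MeasurableSet.iInter fun j => ?_).inter
    (MeasurableSet.iInter fun i => measurableSet_Ioo.preimage (measurable_pi_apply i))
  by_cases hij : i = j
  · simp [hij]
  · simp only [hij, imp_false]
    exact (measurableSet_eq_fun (measurable_pi_apply i) (measurable_pi_apply j)).compl

/-- The sorting permutation is characterized by finitely many comparisons of scores, with ties
broken by index. -/
theorem measurableSet_sort_eq (e : Equiv.Perm (Fin n)) :
    MeasurableSet {S : Fin n → ℝ | Tuple.sort S = e} := by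
  have : {S : Fin n → ℝ | Tuple.sort S = e} =
      ⋂ i, ⋂ j, {S : Fin n → ℝ | (i ≤ j → S (e i) ≤ S (e j)) ∧
        (i < j → S (e i) = S (e j) → e i < e j)} := by
    ext S
    simp only [mem_ofPred_eq, mem_iInter]
    rw [eq_comm, Tuple.eq_sort_iff]
    constructor
    · rintro ⟨h1, h2⟩ i j
      exact ⟨fun hij => h1 hij, h2 i j⟩
    · intro h
      exact ⟨fun i j hij => (h i j).1 hij, fun i j => (h i j).2⟩
  rw [this]
  refine MeasurableSet.iInter fun i => MeasurableSet.iInter fun j => ?_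
  have h1 : MeasurableSet {S : Fin n → ℝ | S (e i) ≤ S (e j)} :=
    measurableSet_le (measurable_pi_apply _) (measurable_pi_apply _)
  have h2 : MeasurableSet {S : Fin n → ℝ | S (e i) = S (e j)} :=
    measurableSet_eq_fun (measurable_pi_apply _) (measurable_pi_apply _)
  exact ((MeasurableSet.const (i ≤ j)).imp h1).inter
    ((MeasurableSet.const (i < j)).imp (h2.imp (MeasurableSet.const _)))

theorem measurable_apply_sort (k : Fin n) :
    Measurable fun x : (Fin n → ℝ) × (Fin n → ℝ) => x.2 (Tuple.sort x.1 k) := by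
  have : (fun x : (Fin n → ℝ) × (Fin n → ℝ) => x.2 (Tuple.sort x.1 k)) =
      fun x => ∑ e : Equiv.Perm (Fin n),
        {y : (Fin n → ℝ) × (Fin n → ℝ) | Tuple.sort y.1 = e}.indicator (fun y => y.2 (e k)) x := by
    ext x
    rw [Finset.sum_eq_single (Tuple.sort x.1)]
    · simp
    · intro e _ he
      exact indicator_of_notMem (fun h => he h.symm) _
    · simp
  rw [this]
  refine Finset.measurable_sum _ fun e _ => Measurable.indicator ?_
    ((measurableSet_sort_eq e).preimage measurable_fst)
  exact (measurable_pi_apply _).comp measurable_snd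

theorem measurable_orderStat (k : ℕ) : Measurable fun S : Fin n → ℝ => orderStat S k := by
  unfold orderStat
  split_ifs with h1 h2
  · exact measurable_const
  · exact (measurable_apply_sort ⟨k - 1, h2⟩).comp (measurable_id.prodMk measurable_id)
  · exact measurable_const

theorem measurable_orderedLabel (k : ℕ) :
    Measurable fun x : (Fin n → ℝ) × (Fin n → ℝ) => orderedLabel x.1 x.2 k := by
  unfold orderedLabel
  split_ifs with h1
  · exact measurable_apply_sort ⟨k - 1, h1⟩
  · exact measurable_const

theorem orderedLabel_mem_Icc (S : Fin n → ℝ) {Y : Fin n → ℝ} (h : ∀ i, Y i ∈ Icc (0 : ℝ) 1)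
    (k : ℕ) : orderedLabel S Y k ∈ Icc (0 : ℝ) 1 := by
  unfold orderedLabel
  split_ifs
  · exact h _
  · simp

end OrderStat

/-! ### Independent samples: ties, expected bin mass, resampling -/

section Sampling
variable {Z : Type*} [MeasurableSpace Z] {μ : Measure Z} [IsProbabilityMeasure μ]

/-- The shift `c` serves two uses: `c = 0` excludes tied scores, and a general `c` excludes equal
bin values. -/
theorem pi_eq_add_const_null {ι : Type*} [Fintype ι] {f : Z → ℝ} (hf : Measurable f)
    (h0 : ∀ c, μ {z | f z = c} = 0) {i j : ι} (hij : i ≠ j) :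
    ∀ c : ℝ, (Measure.pi fun _ : ι => μ) {ω | f (ω i) = f (ω j) + c} = 0 := by
  intro c
  have hind : IndepFun (fun ω : ι → Z => ω i) (fun ω => ω j) (Measure.pi fun _ => μ) :=
    (iIndepFun_pi (μ := fun _ : ι => μ) (X := fun _ => id) fun _ => aemeasurable_id).indepFun hij
  rw [indepFun_iff_map_prod_eq_prod_map_map (measurable_pi_apply i).aemeasurable
      (measurable_pi_apply j).aemeasurable,
    (measurePreserving_eval (fun _ : ι => μ) i).map_eq,
    (measurePreserving_eval (fun _ : ι => μ) j).map_eq] at hind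
  have hs : MeasurableSet {x : Z × Z | f x.1 = f x.2 + c} :=
    measurableSet_eq_fun (by fun_prop) (by fun_prop)
  have : (Measure.pi fun _ : ι => μ) {ω | f (ω i) = f (ω j) + c} =
      (μ.prod μ) {x : Z × Z | f x.1 = f x.2 + c} := by
    rw [← hind, Measure.map_apply (by fun_prop) hs]
    rfl
  rw [this, Measure.measure_prod_null hs]
  refine ae_of_all _ fun x => ?_
  rw [Pi.zero_apply, ← h0 (f x - c)]
  refine congrArg μ (Set.ext fun y => ?_)
  simp only [mem_preimage, mem_ofPred_eq]
  constructor <;> intro h <;> linarith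

theorem ae_noTies {n : ℕ} {S : Z → ℝ} (hS : Measurable S)
    (h0 : ∀ c, μ {z | S z = c} = 0) (h01 : ∀ᵐ z ∂μ, S z ∈ Ioo (0 : ℝ) 1) :
    ∀ᵐ ω ∂(Measure.pi fun _ : Fin n => μ), NoTies fun i => S (ω i) := by
  have h1 : ∀ᵐ ω ∂(Measure.pi fun _ : Fin n => μ), ∀ i j, i ≠ j → S (ω i) ≠ S (ω j) := by
    rw [ae_all_iff]; intro i
    rw [ae_all_iff]; intro j
    by_cases hij : i = j
    · simp [hij]
    · filter_upwards [compl_mem_ae_iff.2 (pi_eq_add_const_null hS h0 hij 0)] with ω hω _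
      simpa using hω
  have h2 : ∀ᵐ ω ∂(Measure.pi fun _ : Fin n => μ), ∀ i, S (ω i) ∈ Ioo (0 : ℝ) 1 :=
    ae_all_iff.2 fun i => (measurePreserving_eval (fun _ : Fin n => μ) i).quasiMeasurePreserving.ae h01
  filter_upwards [h1, h2] with ω hω hω'
  exact ⟨fun i j hij => by_contra fun hne => hω i j hne hij, hω'⟩

open Classical in
/-- The number of scores at most `x`. -/
def rank {n : ℕ} (S : Fin n → ℝ) (x : ℝ) : ℕ := (Finset.univ.filter fun i => S i ≤ x).card

theorem measurable_rank {n : ℕ} : Measurable fun q : (Fin n → ℝ) × ℝ => rank q.1 q.2 := by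
  unfold rank
  simp only [Finset.card_filter]
  refine Finset.measurable_sum _ fun i _ => Measurable.ite ?_ measurable_const measurable_const
  exact measurableSet_le ((measurable_pi_apply i).comp measurable_fst) measurable_snd

theorem mem_Ico_orderStat_iff {n : ℕ} (S : Fin n → ℝ) (l u : ℕ) {s : ℝ} (h0 : 0 ≤ s) (h1 : s < 1) :
    s ∈ Ico (orderStat S l) (orderStat S u) ↔ rank S s ∈ Ico l u := by
  rw [mem_Ico, mem_Ico, ← not_le (a := orderStat S u), ← not_le (a := u),
    orderStat_le_iff S l h0 h1, orderStat_le_iff S u h0 h1]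
  unfold rank
  convert Iff.rfl

/-- Each leave-one-out rank is one less than the full count, which includes the point itself. So `n
+ 1` distinct scores have distinct leave-one-out ranks. -/
theorem rank_succAbove_lt {n : ℕ} (S : Fin (n + 1) → ℝ) {i k : Fin (n + 1)} (h : S i < S k) :
    rank (fun j => S (i.succAbove j)) (S i) < rank (fun j => S (k.succAbove j)) (S k) := by
  classical
  have key : ∀ i, (Finset.univ.filter fun j => S j ≤ S i).card =
      1 + rank (fun j => S (i.succAbove j)) (S i) := by
    intro i
    unfold rank
    rw [Finset.card_filter, Fin.sum_univ_succAbove _ i, Finset.card_filter]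
    simp
  have h2 : (Finset.univ.filter fun j => S j ≤ S i).card <
      (Finset.univ.filter fun j => S j ≤ S k).card := by
    apply Finset.card_lt_card
    refine ⟨fun j hj => ?_, fun hc => ?_⟩
    · simp only [Finset.mem_filter, Finset.mem_univ, true_and] at hj ⊢
      exact hj.trans h.le
    · have := hc (x := k) (by simp)
      simp only [Finset.mem_filter, Finset.mem_univ, true_and] at this
      exact this.not_gt h
  rw [key, key] at h2
  omega

theorem measurableSet_prod_Ico {S : Z → ℝ} (hS : Measurable S) :
    MeasurableSet {x : (ℝ × ℝ) × Z | S x.2 ∈ Ico x.1.1 x.1.2} := by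
  have h1 : MeasurableSet {x : (ℝ × ℝ) × Z | x.1.1 ≤ S x.2} :=
    measurableSet_le (by fun_prop) (by fun_prop)
  have h2 : MeasurableSet {x : (ℝ × ℝ) × Z | S x.2 < x.1.2} :=
    measurableSet_lt (by fun_prop) (by fun_prop)
  exact h1.inter h2

theorem measurable_measure_Ico {S : Z → ℝ} (hS : Measurable S) :
    Measurable fun q : ℝ × ℝ => μ {z | S z ∈ Ico q.1 q.2} :=
  measurable_measure_prodMk_left (measurableSet_prod_Ico hS)

/-- The expected mass between two order statistics of an independent sample. -/
theorem lintegral_mass_le {n : ℕ} {S : Z → ℝ} (hS : Measurable S)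
    (h0 : ∀ c, μ {z | S z = c} = 0) (h01 : ∀ᵐ z ∂μ, S z ∈ Ioo (0 : ℝ) 1) (l u : ℕ) :
    ∫⁻ ω, μ {z | S z ∈ Ico (orderStat (fun i => S (ω i)) l) (orderStat (fun i => S (ω i)) u)}
      ∂(Measure.pi fun _ : Fin n => μ) ≤ ((u - l : ℕ) : ENNReal) / (n + 1 : ℕ) := by
  classical
  set A : Set (Z × (Fin n → Z)) := {x | rank (fun i => S (x.2 i)) (S x.1) ∈ Ico l u} with hA
  have hmA : MeasurableSet A := by
    have : Measurable fun x : Z × (Fin n → Z) => rank (fun i => S (x.2 i)) (S x.1) :=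
      measurable_rank.comp (f := fun x : Z × (Fin n → Z) => ((fun i => S (x.2 i)), S x.1))
        (by fun_prop)
    exact this (measurableSet_Ico)
  have e1 : ∫⁻ ω, μ {z | S z ∈ Ico (orderStat (fun i => S (ω i)) l)
      (orderStat (fun i => S (ω i)) u)} ∂(Measure.pi fun _ : Fin n => μ) =
      (μ.prod (Measure.pi fun _ : Fin n => μ)) A := by
    rw [Measure.prod_apply_symm hmA]
    refine lintegral_congr fun ω => measure_congr ?_
    filter_upwards [h01] with z hz
    exact propext (mem_Ico_orderStat_iff (fun i => S (ω i)) l u hz.1.le hz.2)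
  rw [e1]
  -- Exchangeability: any of `n + 1` independent points can play the test point.
  have e2 : ∀ i : Fin (n + 1), (μ.prod (Measure.pi fun _ : Fin n => μ)) A =
      ∫⁻ ω, (MeasurableEquiv.piFinSuccAbove (fun _ => Z) i ⁻¹' A).indicator 1 ω
        ∂(Measure.pi fun _ : Fin (n + 1) => μ) := by
    intro i
    rw [lintegral_indicator_one ((MeasurableEquiv.measurable _) hmA),
      (measurePreserving_piFinSuccAbove (fun _ => μ) i).measure_preimage hmA.nullMeasurableSet]
  have e3 : ((n + 1 : ℕ) : ENNReal) * (μ.prod (Measure.pi fun _ : Fin n => μ)) A =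
      ∫⁻ ω, ∑ i : Fin (n + 1),
        (MeasurableEquiv.piFinSuccAbove (fun _ => Z) i ⁻¹' A).indicator 1 ω
        ∂(Measure.pi fun _ : Fin (n + 1) => μ) := by
    rw [lintegral_finsetSum _ fun i _ => measurable_one.indicator
      ((MeasurableEquiv.measurable _) hmA), ← Finset.sum_congr rfl fun i _ => e2 i]
    simp
  rw [ENNReal.le_div_iff_mul_le (by simp) (by simp), mul_comm, e3]
  calc _ ≤ ∫⁻ ω, ((u - l : ℕ) : ENNReal) ∂(Measure.pi fun _ : Fin (n + 1) => μ) := by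
        refine lintegral_mono_ae ?_
        filter_upwards [ae_noTies (n := n + 1) hS h0 h01] with ω hω
        have : ∀ i, (MeasurableEquiv.piFinSuccAbove (fun _ => Z) i ⁻¹' A).indicator 1 ω =
            if rank (fun j => S (ω (i.succAbove j))) (S (ω i)) ∈ Finset.Ico l u
              then (1 : ENNReal) else 0 := by
          intro i
          simp only [indicator, mem_preimage, Finset.mem_Ico]
          rfl
        simp only [this, Finset.sum_boole, Nat.cast_le]
        rw [← Nat.card_Ico]
        -- The leave-one-out ranks are distinct, so at most `u - l` of them lie in `[l, u)`.
        refine Finset.card_le_card_of_injOn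
          (fun i => rank (fun j => S (ω (i.succAbove j))) (S (ω i))) (fun i hi => ?_) ?_
        · simpa using hi
        · intro i _ k _ hik
          rcases lt_trichotomy (S (ω i)) (S (ω k)) with h | h | h
          · exact absurd hik (rank_succAbove_lt (fun j => S (ω j)) h).ne
          · exact hω.1 h
          · exact absurd hik (rank_succAbove_lt (fun j => S (ω j)) h).ne'
    _ = _ := by simp

theorem measurableSet_inner_eq {n : ℕ} (l u : ℕ) (M : Finset (Fin n)) :
    MeasurableSet {S : Fin n → ℝ | inner l u S = M} := by
  have : {S : Fin n → ℝ | inner l u S = M} =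
      ⋂ i, {S | (orderStat S l < S i ∧ S i < orderStat S u) ↔ i ∈ M} := by
    ext S
    simp [Finset.ext_iff, mem_inner]
  rw [this]
  refine MeasurableSet.iInter fun i => MeasurableSet.iff ?_ (MeasurableSet.const _)
  exact (measurableSet_lt (measurable_orderStat l) (measurable_pi_apply i)).inter
    (measurableSet_lt (measurable_pi_apply i) (measurable_orderStat u))

/-- Given the boundaries of a bin, the points in the bin are independent draws from the law of a
test point, conditioned to fall into the bin: a bound on the mean of `φ` under the latter law gives
one on the mean of `φ` over the sample. This is the part of the sample space where the points with
index in `M` make up the bin. -/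
theorem lintegral_resample_inner {n : ℕ} {S Y : Z → ℝ} (hS : Measurable S) (hY : Measurable Y)
    (h0 : ∀ c, μ {z | S z = c} = 0) (h01 : ∀ᵐ z ∂μ, S z ∈ Ioo (0 : ℝ) 1)
    {l u : ℕ} (hl : l ≤ n) (hu : 0 < u)
    {w : ℝ × ℝ → ENNReal} (hw : Measurable w) {φ : ℝ × ℝ → ℝ → ENNReal}
    (hφ : Measurable fun q : (ℝ × ℝ) × ℝ => φ q.1 q.2) {C : ENNReal} (M : Finset (Fin n))
    (hC : ∀ {ι : Type} [Fintype ι], Fintype.card ι = M.card → ∀ s t,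
      ∫⁻ x in univ.pi fun _ : ι => S ⁻¹' Ioo s t, φ (s, t) ((∑ k, Y (x k)) / M.card)
        ∂(Measure.pi fun _ : ι => μ) ≤
      C * (Measure.pi fun _ : ι => μ) (univ.pi fun _ : ι => S ⁻¹' Ioo s t)) :
    ∫⁻ ω in {ω | NoTies (fun i => S (ω i)) ∧ inner l u (fun i => S (ω i)) = M},
      w (orderStat (fun i => S (ω i)) l, orderStat (fun i => S (ω i)) u) *
        φ (orderStat (fun i => S (ω i)) l, orderStat (fun i => S (ω i)) u)
          ((∑ i ∈ M, Y (ω i)) / M.card) ∂(Measure.pi fun _ : Fin n => μ) ≤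
    C * ∫⁻ ω in {ω | NoTies (fun i => S (ω i)) ∧ inner l u (fun i => S (ω i)) = M},
      w (orderStat (fun i => S (ω i)) l, orderStat (fun i => S (ω i)) u)
        ∂(Measure.pi fun _ : Fin n => μ) := by
  classical
  set E : Set (Fin n → Z) := {ω | NoTies (fun i => S (ω i)) ∧ inner l u (fun i => S (ω i)) = M}
  have hmS : Measurable fun ω : Fin n → Z => fun i => S (ω i) := by fun_prop
  have hE : MeasurableSet E :=
    (measurableSet_noTies.preimage hmS).inter ((measurableSet_inner_eq l u M).preimage hmS)
  set q : (Fin n → Z) → ℝ × ℝ :=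
    fun ω => (orderStat (fun i => S (ω i)) l, orderStat (fun i => S (ω i)) u)
  have hq : Measurable q :=
    ((measurable_orderStat l).comp hmS).prodMk ((measurable_orderStat u).comp hmS)
  have hF : Measurable fun ω : Fin n → Z => w (q ω) * φ (q ω) ((∑ i ∈ M, Y (ω i)) / M.card) := by
    refine (hw.comp hq).mul (hφ.comp (hq.prodMk ?_))
    fun_prop
  have hG : Measurable fun ω => w (q ω) := hw.comp hq
  rw [← lintegral_indicator hE, ← lintegral_indicator hE]
  change ∫⁻ ω, E.indicator (fun ω => w (q ω) * φ (q ω) ((∑ i ∈ M, Y (ω i)) / M.card)) ω ∂_ ≤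
    C * ∫⁻ ω, E.indicator (fun ω => w (q ω)) ω ∂_
  -- The coordinates off `M` come first, so Fubini fixes the outer points and integrates over the
  -- inner ones.
  have hmp := (measurePreserving_piEquivPiSubtypeProd (fun _ : Fin n => μ) (· ∉ M)).symm
  set e := (MeasurableEquiv.piEquivPiSubtypeProd (fun _ : Fin n => Z) (· ∉ M)).symm
  have hFe : Measurable fun z => E.indicator
      (fun ω => w (q ω) * φ (q ω) ((∑ i ∈ M, Y (ω i)) / M.card)) (e z) :=
    (hF.indicator hE).comp e.measurable
  have hGe : Measurable fun z => E.indicator (fun ω => w (q ω)) (e z) :=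
    (hG.indicator hE).comp e.measurable
  rw [← hmp.lintegral_comp (hF.indicator hE), ← hmp.lintegral_comp (hG.indicator hE),
    lintegral_prod _ hFe.aemeasurable,
    lintegral_prod _ hGe.aemeasurable,
    ← lintegral_const_mul _ hGe.lintegral_prod_right']
  have hties := Measure.ae_ae_of_ae_prod
    (hmp.quasiMeasurePreserving.ae (ae_noTies (n := n) hS h0 h01))
  refine lintegral_mono_ae ?_
  filter_upwards [hties] with y hy
  -- On an empty section both sides vanish. Otherwise one witness `x₀` supplies the boundaries `(s,
  -- t)` of the whole section.
  by_cases hne : ∃ x, e (y, x) ∈ E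
  swap
  · push Not at hne
    simp [hne]
  obtain ⟨x₀, hx₀⟩ := hne
  obtain ⟨s, t, hst⟩ : ∃ s t, q (e (y, x₀)) = (s, t) := ⟨_, _, rfl⟩
  have hout : ∀ x x' i, i ∉ M → S (e (y, x) i) = S (e (y, x') i) := by
    intro x x' i hi
    simp [e, MeasurableEquiv.piEquivPiSubtypeProd, Equiv.piEquivPiSubtypeProd, hi]
  have hin : ∀ x (i : Fin n) (hi : ¬ i ∉ M), e (y, x) i = x ⟨i, hi⟩ := by
    intro x i hi
    have hi' : i ∈ M := not_not.1 hi
    simp [e, MeasurableEquiv.piEquivPiSubtypeProd, Equiv.piEquivPiSubtypeProd, hi']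
  set J : Set ({i // ¬ i ∉ M} → Z) := univ.pi fun _ => S ⁻¹' Ioo s t
  have hJ : MeasurableSet J := MeasurableSet.univ_pi fun _ => measurableSet_Ioo.preimage hS
  have hsec : ∀ x, e (y, x) ∈ E → q (e (y, x)) = (s, t) ∧ x ∈ J := by
    intro x hx
    have h := orderStat_eq_of_inner_eq hx₀.1 hx.1 (hout x₀ x) hl hu hx₀.2 hx.2
    have hqx : q (e (y, x)) = (s, t) := by
      rw [← hst]; exact Prod.ext h.1 h.2
    refine ⟨hqx, fun k _ => ?_⟩
    have hk : (k : Fin n) ∈ inner l u (fun i => S (e (y, x) i)) := by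
      rw [hx.2]; exact not_not.1 k.2
    rw [mem_inner, show orderStat (fun i => S (e (y, x) i)) l = s from congrArg Prod.fst hqx,
      show orderStat (fun i => S (e (y, x) i)) u = t from congrArg Prod.snd hqx,
      hin x k k.2] at hk
    exact hk
  -- With `hsec`, the section of `E` equals the product set `J` up to the null set of ties.
  have hsec' : ∀ x, NoTies (fun i => S (e (y, x) i)) → x ∈ J → e (y, x) ∈ E := by
    intro x hx hxJ
    refine ⟨hx, inner_eq_of_mem_Ioo hx₀.1 hx (hout x₀ x) hl hu hx₀.2 fun i hi => ?_⟩
    have := hxJ ⟨i, not_not.2 hi⟩ (mem_univ _)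
    rw [mem_preimage, ← hin x i (not_not.2 hi)] at this
    rwa [show orderStat (fun i => S (e (y, x₀) i)) l = s from congrArg Prod.fst hst,
      show orderStat (fun i => S (e (y, x₀) i)) u = t from congrArg Prod.snd hst]
  have hsum : ∀ x : {i // ¬ i ∉ M} → Z, ∑ i ∈ M, Y (e (y, x) i) = ∑ k, Y (x k) := by
    intro x
    rw [Finset.sum_subtype M (p := fun i => ¬ i ∉ M) (fun i => by simp)
      (f := fun i => Y (e (y, x) i))]
    exact Finset.sum_congr rfl fun k _ => by rw [hin x k k.2]
  have hL : ∀ᵐ x ∂(Measure.pi fun _ : {i // ¬ i ∉ M} => μ),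
      E.indicator (fun ω => w (q ω) * φ (q ω) ((∑ i ∈ M, Y (ω i)) / M.card)) (e (y, x)) =
      J.indicator (fun x => w (s, t) * φ (s, t) ((∑ k, Y (x k)) / M.card)) x := by
    filter_upwards [hy] with x hx
    by_cases hxJ : x ∈ J
    · have hxE := hsec' x hx hxJ
      rw [indicator_of_mem hxE, indicator_of_mem hxJ, (hsec x hxE).1, hsum]
    · rw [indicator_of_notMem hxJ, indicator_of_notMem fun hxE => hxJ (hsec x hxE).2]
  have hR : ∀ᵐ x ∂(Measure.pi fun _ : {i // ¬ i ∉ M} => μ),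
      E.indicator (fun ω => w (q ω)) (e (y, x)) = J.indicator (fun x => w (s, t)) x := by
    filter_upwards [hy] with x hx
    by_cases hxJ : x ∈ J
    · have hxE := hsec' x hx hxJ
      rw [indicator_of_mem hxE, indicator_of_mem hxJ, (hsec x hxE).1]
    · rw [indicator_of_notMem hxJ, indicator_of_notMem fun hxE => hxJ (hsec x hxE).2]
  have hφm : Measurable fun x : {i // ¬ i ∉ M} → Z => φ (s, t) ((∑ k, Y (x k)) / M.card) :=
    hφ.comp (measurable_const.prodMk (by fun_prop))
  rw [lintegral_congr_ae hL, lintegral_congr_ae hR,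
    lintegral_indicator hJ, lintegral_indicator hJ, lintegral_const_mul _ hφm, setLIntegral_const,
    mul_left_comm]
  refine mul_le_mul_right (hC ?_ s t) _
  simp

/-- Sums `lintegral_resample_inner` over all possible inner sets, which share the size `N` and the
constant `C`. The weight `w` will be `1` for probabilities over the sample alone and the bin mass
when a test point is averaged too. -/
theorem lintegral_resample {n : ℕ} {S Y : Z → ℝ} (hS : Measurable S) (hY : Measurable Y)
    (h0 : ∀ c, μ {z | S z = c} = 0) (h01 : ∀ᵐ z ∂μ, S z ∈ Ioo (0 : ℝ) 1)
    {l u N : ℕ} (hl : l ≤ n) (hu : 0 < u) (hun : u ≤ n + 1) (hN : N = u - l - 1)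
    {w : ℝ × ℝ → ENNReal} (hw : Measurable w) {φ : ℝ × ℝ → ℝ → ENNReal}
    (hφ : Measurable fun q : (ℝ × ℝ) × ℝ => φ q.1 q.2) {C : ENNReal}
    (hC : ∀ {ι : Type} [Fintype ι], Fintype.card ι = N → ∀ s t,
      ∫⁻ x in univ.pi fun _ : ι => S ⁻¹' Ioo s t, φ (s, t) ((∑ k, Y (x k)) / N)
        ∂(Measure.pi fun _ : ι => μ) ≤
      C * (Measure.pi fun _ : ι => μ) (univ.pi fun _ : ι => S ⁻¹' Ioo s t)) :
    ∫⁻ ω, w (orderStat (fun i => S (ω i)) l, orderStat (fun i => S (ω i)) u) *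
        φ (orderStat (fun i => S (ω i)) l, orderStat (fun i => S (ω i)) u)
          ((∑ k ∈ Finset.Ioo l u, orderedLabel (fun i => S (ω i)) (fun i => Y (ω i)) k) / N)
        ∂(Measure.pi fun _ : Fin n => μ) ≤
    C * ∫⁻ ω, w (orderStat (fun i => S (ω i)) l, orderStat (fun i => S (ω i)) u)
        ∂(Measure.pi fun _ : Fin n => μ) := by
  classical
  have hmS : Measurable fun ω : Fin n → Z => fun i => S (ω i) := by fun_prop
  set q : (Fin n → Z) → ℝ × ℝ :=
    fun ω => (orderStat (fun i => S (ω i)) l, orderStat (fun i => S (ω i)) u)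
  have hq : Measurable q :=
    ((measurable_orderStat l).comp hmS).prodMk ((measurable_orderStat u).comp hmS)
  set E : Finset (Fin n) → Set (Fin n → Z) :=
    fun M => {ω | NoTies (fun i => S (ω i)) ∧ inner l u (fun i => S (ω i)) = M}
  have hE : ∀ M, MeasurableSet (E M) := fun M =>
    (measurableSet_noTies.preimage hmS).inter ((measurableSet_inner_eq l u M).preimage hmS)
  have split : ∀ F G : (Fin n → Z) → ENNReal, Measurable F → Measurable G →
      (∀ M : Finset (Fin n), M.card = N →
        ∫⁻ ω in E M, F ω ∂(Measure.pi fun _ : Fin n => μ) ≤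
          C * ∫⁻ ω in E M, G ω ∂(Measure.pi fun _ : Fin n => μ)) →
      ∫⁻ ω, F ω ∂(Measure.pi fun _ : Fin n => μ) ≤
        C * ∫⁻ ω, G ω ∂(Measure.pi fun _ : Fin n => μ) := by
    intro F G hF hG h
    -- Almost every sample lies in `E M` for exactly one `M`, and this `M` has `N` elements.
    have dec : ∀ F : (Fin n → Z) → ENNReal, Measurable F →
        ∫⁻ ω, F ω ∂(Measure.pi fun _ : Fin n => μ) =
        ∑ M ∈ Finset.powersetCard N Finset.univ,
          ∫⁻ ω in E M, F ω ∂(Measure.pi fun _ : Fin n => μ) := by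
      intro F hF
      simp_rw [← lintegral_indicator (hE _)]
      rw [← lintegral_finsetSum _ fun M _ => hF.indicator (hE M)]
      refine lintegral_congr_ae ?_
      filter_upwards [ae_noTies (n := n) hS h0 h01] with ω hω
      rw [Finset.sum_eq_single_of_mem (inner l u fun i => S (ω i))]
      · rw [indicator_of_mem]
        exact ⟨hω, rfl⟩
      · rw [Finset.mem_powersetCard_univ, hω.card_inner hl hun, hN]
      · intro M _ hM
        exact indicator_of_notMem (fun h => hM h.2.symm) _
    rw [dec F hF, dec G hG, Finset.mul_sum]
    exact Finset.sum_le_sum fun M hM => h M (Finset.mem_powersetCard_univ.1 hM)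
  refine split _ _ ?_ (hw.comp hq) fun M hM => ?_
  · refine (hw.comp hq).mul (hφ.comp (hq.prodMk ?_))
    refine Measurable.div_const (Finset.measurable_sum _ fun k _ => ?_) _
    exact (measurable_orderedLabel k).comp
      (f := fun ω : Fin n → Z => ((fun i => S (ω i)), fun i => Y (ω i))) (by fun_prop)
  · subst hM
    refine le_of_eq_of_le ?_ (lintegral_resample_inner hS hY h0 h01 hl hu hw hφ M hC)
    refine setLIntegral_congr_fun (hE M) fun ω hω => ?_
    simp only [hω.1.sum_inner hl hun, hω.2]

end Sampling

/-! ### Concentration of the mean of independent `[0, 1]`-valued labels -/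

section Concentration
variable {Z : Type*} [MeasurableSpace Z]

theorem pi_smul_measure {ι : Type*} [Fintype ι] (c : ENNReal) (hc : c ≠ ⊤) (ν : Measure Z)
    [IsProbabilityMeasure ν] :
    Measure.pi (fun _ : ι => c • ν) = c ^ Fintype.card ι • Measure.pi fun _ : ι => ν := by
  have : IsFiniteMeasure (c • ν) := ν.smul_finite hc
  refine Measure.pi_eq fun s _ => ?_
  simp [Measure.pi_pi, Finset.prod_mul_distrib]

/-- `μ` restricted to `J` is `μ J` times the conditional law; the product of the restrictions
inherits one such factor per coordinate. -/
theorem setLIntegral_univ_pi {μ : Measure Z} [IsProbabilityMeasure μ] {ι : Type*} [Fintype ι]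
    {J : Set Z} (hJ0 : μ J ≠ 0) (F : (ι → Z) → ENNReal) :
    ∫⁻ x in univ.pi fun _ : ι => J, F x ∂(Measure.pi fun _ : ι => μ) =
      (Measure.pi fun _ : ι => μ) (univ.pi fun _ : ι => J) *
        ∫⁻ x, F x ∂(Measure.pi fun _ : ι => μ[|J]) := by
  have := cond_isProbabilityMeasure hJ0
  have h : μ.restrict J = μ J • μ[|J] := by
    rw [ProbabilityTheory.cond, smul_smul, ENNReal.mul_inv_cancel hJ0 (measure_ne_top _ _), one_smul]
  rw [Measure.restrict_pi_pi, h, pi_smul_measure _ (measure_ne_top _ _), lintegral_smul_measure,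
    Measure.pi_pi]
  simp

variable {ν : Measure Z} [IsProbabilityMeasure ν] {Y : Z → ℝ} {ι : Type*} [Fintype ι]

/-- Hoeffding: a centred label has variance proxy `1/4`, and the threshold `N ε` for the sum gives
the exponent `(N ε)² / (2 · N/4) = 2 N ε²`. -/
theorem measure_mean_sub_ge_le (hY : Measurable Y) (h01 : ∀ z, Y z ∈ Icc (0 : ℝ) 1) {N : ℕ}
    (hN : 0 < N) (hι : Fintype.card ι = N) {ε : ℝ} (hε : 0 ≤ ε) :
    (Measure.pi fun _ : ι => ν).real {x | ε ≤ (∑ k, Y (x k)) / N - ∫ z, Y z ∂ν} ≤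
      Real.exp (-2 * N * ε ^ 2) := by
  have hN' : (0 : ℝ) < N := by exact_mod_cast hN
  have hind : iIndepFun (fun (k : ι) (x : ι → Z) => Y (x k) - ∫ z, Y z ∂ν)
      (Measure.pi fun _ : ι => ν) :=
    iIndepFun_pi (μ := fun _ : ι => ν) (X := fun _ z => Y z - ∫ z, Y z ∂ν)
      fun _ => by fun_prop
  have hsub : ∀ k : ι, HasSubgaussianMGF (fun x : ι → Z => Y (x k) - ∫ z, Y z ∂ν)
      ((‖(1 : ℝ) - 0‖₊ / 2) ^ 2) (Measure.pi fun _ : ι => ν) := by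
    intro k
    have h := hasSubgaussianMGF_of_mem_Icc (μ := Measure.pi fun _ : ι => ν)
      (X := fun x : ι → Z => Y (x k)) (a := 0) (b := 1)
      (hY.comp (measurable_pi_apply k)).aemeasurable (ae_of_all _ fun x => h01 _)
    rwa [integral_comp_eval (μ := fun _ : ι => ν) (i := k) hY.aestronglyMeasurable] at h
  have := HasSubgaussianMGF.measure_sum_ge_le_of_iIndepFun hind (s := Finset.univ)
    (fun k _ => hsub k) (ε := N * ε) (by positivity)
  convert this using 2
  · congr 1
    ext x
    simp only [Finset.sum_sub_distrib, Finset.sum_const, Finset.card_univ, hι,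
      nsmul_eq_mul]
    rw [le_sub_iff_add_le, le_sub_iff_add_le, le_div_iff₀ hN']
    constructor <;> intro h <;> linarith
  · simp only [sub_zero, nnnorm_one, Finset.sum_const, Finset.card_univ, hι, nsmul_eq_mul]
    push_cast
    field_simp

theorem measure_abs_mean_sub_ge_le (hY : Measurable Y) (h01 : ∀ z, Y z ∈ Icc (0 : ℝ) 1) {N : ℕ}
    (hN : 0 < N) (hι : Fintype.card ι = N) {ε : ℝ} (hε : 0 ≤ ε) :
    (Measure.pi fun _ : ι => ν) {x | ε ≤ |(∑ k, Y (x k)) / N - ∫ z, Y z ∂ν|} ≤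
      ENNReal.ofReal (2 * Real.exp (-2 * N * ε ^ 2)) := by
  have hN' : (0 : ℝ) < N := by exact_mod_cast hN
  have h1 := measure_mean_sub_ge_le (ν := ν) hY h01 hN hι hε
  have hint : Integrable Y ν := Integrable.of_mem_Icc 0 1 hY.aemeasurable (ae_of_all _ h01)
  -- The lower tail is the upper tail of `1 - Y`.
  have h2 := measure_mean_sub_ge_le (ν := ν) (Y := fun z => 1 - Y z) (by fun_prop)
    (fun z => ⟨by linarith [(h01 z).2], by linarith [(h01 z).1]⟩) hN hι hε
  have e2 : {x : ι → Z | ε ≤ (∑ k, (1 - Y (x k))) / N - ∫ z, (1 - Y z) ∂ν} =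
      {x | ε ≤ -((∑ k, Y (x k)) / N - ∫ z, Y z ∂ν)} := by
    ext x
    simp only [mem_ofPred_eq]
    rw [integral_sub (integrable_const _) hint, Finset.sum_sub_distrib]
    simp only [Finset.sum_const, Finset.card_univ, hι, nsmul_eq_mul, mul_one, integral_const,
      probReal_univ, smul_eq_mul]
    rw [sub_div, div_self hN'.ne']
    constructor <;> intro h <;> linarith
  rw [e2] at h2
  rw [← ofReal_measureReal]
  refine ENNReal.ofReal_le_ofReal ?_
  have : {x : ι → Z | ε ≤ |(∑ k, Y (x k)) / N - ∫ z, Y z ∂ν|} =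
      {x | ε ≤ (∑ k, Y (x k)) / N - ∫ z, Y z ∂ν} ∪
        {x | ε ≤ -((∑ k, Y (x k)) / N - ∫ z, Y z ∂ν)} := by
    ext x
    exact le_abs (α := ℝ)
  rw [this]
  linarith [measureReal_union_le (μ := Measure.pi fun _ : ι => ν)
    {x | ε ≤ (∑ k, Y (x k)) / N - ∫ z, Y z ∂ν} {x | ε ≤ -((∑ k, Y (x k)) / N - ∫ z, Y z ∂ν)}]

/-- A `[0, 1]`-valued variable has variance at most `1/4`, and averaging `N` independent copies
divides it by `N`. -/
theorem lintegral_sq_mean_sub_le (hY : Measurable Y) (h01 : ∀ z, Y z ∈ Icc (0 : ℝ) 1) {N : ℕ}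
    (hN : 0 < N) (hι : Fintype.card ι = N) :
    ∫⁻ x, ENNReal.ofReal (((∑ k, Y (x k)) / N - ∫ z, Y z ∂ν) ^ 2) ∂(Measure.pi fun _ : ι => ν) ≤
      ENNReal.ofReal (1 / (4 * N)) := by
  have hN' : (0 : ℝ) < N := by exact_mod_cast hN
  have hmem : MemLp Y 2 ν := memLp_of_bounded (ae_of_all _ h01) hY.aestronglyMeasurable 2
  have hmemk : ∀ k : ι, MemLp (fun x : ι → Z => Y (x k)) 2 (Measure.pi fun _ : ι => ν) :=
    fun k => hmem.comp_measurePreserving (measurePreserving_eval (fun _ : ι => ν) k)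
  have hvar := variance_sum_pi (ι := ι) (μ := fun _ => ν) (X := fun _ => Y) fun _ => hmem
  have hle : variance Y ν ≤ 1 / 4 := by
    refine (variance_le_sq_of_bounded (ae_of_all _ h01) hY.aemeasurable).trans (by norm_num)
  have hsum : MemLp (∑ k, fun x : ι → Z => Y (x k)) 2 (Measure.pi fun _ : ι => ν) :=
    memLp_finsetSum' _ fun k _ => hmemk k
  have hmean : ∫ x, (∑ k, fun x : ι → Z => Y (x k)) x ∂(Measure.pi fun _ : ι => ν) =
      N * ∫ z, Y z ∂ν := by
    simp only [Finset.sum_apply]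
    rw [integral_finsetSum _ fun k _ => (hmemk k).integrable (by norm_num)]
    simp [integral_comp_eval (μ := fun _ : ι => ν) hY.aestronglyMeasurable, hι]
  have key : ∀ x : ι → Z, ENNReal.ofReal (((∑ k, Y (x k)) / N - ∫ z, Y z ∂ν) ^ 2) =
      ENNReal.ofReal (1 / (N : ℝ) ^ 2) * ENNReal.ofReal (((∑ k, fun x : ι → Z => Y (x k)) x -
        ∫ x, (∑ k, fun x : ι → Z => Y (x k)) x ∂(Measure.pi fun _ : ι => ν)) ^ 2) := by
    intro x
    rw [← ENNReal.ofReal_mul (by positivity), hmean]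
    simp only [Finset.sum_apply]
    congr 1
    field_simp
  simp_rw [key]
  rw [lintegral_const_mul' _ _ ENNReal.ofReal_ne_top, ← evariance_eq_lintegral_ofReal, ← ofReal_variance hsum, hvar,
    ← ENNReal.ofReal_mul (by positivity)]
  refine ENNReal.ofReal_le_ofReal ?_
  simp only [Finset.sum_const, Finset.card_univ, hι, nsmul_eq_mul]
  calc 1 / (N : ℝ) ^ 2 * ((N : ℝ) * variance Y ν) ≤ 1 / (N : ℝ) ^ 2 * ((N : ℝ) * (1 / 4)) := by gcongr
    _ = 1 / (4 * (N : ℝ)) := by field_simp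

end Concentration

/-! ### Error of the sample mean in a bin -/

section Bins
variable {Z : Type*} [MeasurableSpace Z] (μ : Measure Z) (S Y : Z → ℝ)

/-- The mean of `Y` given that the score `S` lies in `[q.1, q.2)`. -/
def meanOn (q : ℝ × ℝ) : ℝ :=
  (∫ z in S ⁻¹' Ico q.1 q.2, Y z ∂μ) / μ.real (S ⁻¹' Ico q.1 q.2)

variable {μ S Y}

/-- Inner sample points lie in the open interval, whereas the predictor uses the half-open one;
without atoms the difference is null. -/
theorem preimage_Ioo_ae_eq (h0 : ∀ c, μ {z | S z = c} = 0) (s t : ℝ) :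
    S ⁻¹' Ioo s t =ᵐ[μ] S ⁻¹' Ico s t := by
  filter_upwards [compl_mem_ae_iff.2 (h0 s)] with z hz
  have hz' : S z ≠ s := hz
  refine propext (show (S z ∈ Ioo s t) ↔ (S z ∈ Ico s t) from ?_)
  rw [mem_Ioo, mem_Ico]
  exact ⟨fun h => ⟨h.1.le, h.2⟩, fun h => ⟨lt_of_le_of_ne h.1 hz'.symm, h.2⟩⟩

theorem integral_cond_Ioo (h0 : ∀ c, μ {z | S z = c} = 0) (s t : ℝ) :
    ∫ z, Y z ∂(μ[|S ⁻¹' Ioo s t]) = meanOn μ S Y (s, t) := by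
  have h := preimage_Ioo_ae_eq h0 s t
  rw [ProbabilityTheory.cond, Measure.restrict_congr_set h, measure_congr h, integral_smul_measure, meanOn,
    ENNReal.toReal_inv, smul_eq_mul, div_eq_inv_mul]
  rfl

variable [IsProbabilityMeasure μ]

theorem measurable_meanOn (hS : Measurable S) (hY : Measurable Y) :
    Measurable (meanOn μ S Y) := by
  unfold meanOn
  refine Measurable.div ?_ (measurable_measure_Ico hS).ennreal_toReal
  simp_rw [← integral_indicator (measurableSet_Ico.preimage hS)]
  have : StronglyMeasurable fun x : (ℝ × ℝ) × Z =>
      {x : (ℝ × ℝ) × Z | S x.2 ∈ Ico x.1.1 x.1.2}.indicator (fun x => Y x.2) x :=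
    ((hY.comp measurable_snd).indicator (measurableSet_prod_Ico hS)).stronglyMeasurable
  exact (this.integral_prod_right (ν := μ)).measurable

/-- Reduces the hypothesis of `lintegral_resample` to a bound under the conditional law. For a null
bin both sides vanish, which uses `0 < N`. -/
theorem setLIntegral_mean_le (φ : ℝ × ℝ → ℝ → ENNReal) {s t : ℝ} {ι : Type} [Fintype ι] {N : ℕ}
    (hN : 0 < N) (hι : Fintype.card ι = N) {C : ENNReal}
    (h : μ (S ⁻¹' Ioo s t) ≠ 0 → ∫⁻ x, φ (s, t) ((∑ k, Y (x k)) / N)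
      ∂(Measure.pi fun _ : ι => μ[|S ⁻¹' Ioo s t]) ≤ C) :
    ∫⁻ x in univ.pi fun _ : ι => S ⁻¹' Ioo s t, φ (s, t) ((∑ k, Y (x k)) / N)
        ∂(Measure.pi fun _ : ι => μ) ≤
      C * (Measure.pi fun _ : ι => μ) (univ.pi fun _ : ι => S ⁻¹' Ioo s t) := by
  by_cases hJ : μ (S ⁻¹' Ioo s t) = 0
  · have h0 : (Measure.pi fun _ : ι => μ) (univ.pi fun _ : ι => S ⁻¹' Ioo s t) = 0 := by
      rw [Measure.pi_pi]
      simp [hJ, hι, hN.ne']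
    rw [Measure.restrict_zero_set h0]
    simp
  · rw [setLIntegral_univ_pi hJ, mul_comm]
    exact mul_le_mul_left (h hJ) _

variable {n : ℕ} {l u N : ℕ}

/-- Weighted deviation probability of the mean label of a bin. -/
theorem lintegral_deviation_le (hS : Measurable S) (hY : Measurable Y)
    (hY01 : ∀ z, Y z ∈ Icc (0 : ℝ) 1) (h0 : ∀ c, μ {z | S z = c} = 0)
    (h01 : ∀ᵐ z ∂μ, S z ∈ Ioo (0 : ℝ) 1) (hlu : l + 1 < u) (hun : u ≤ n + 1)
    (hN : N = u - l - 1) {w : ℝ × ℝ → ENNReal} (hw : Measurable w) {ε : ℝ} (hε : 0 ≤ ε) :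
    ∫⁻ ω, w (orderStat (fun i => S (ω i)) l, orderStat (fun i => S (ω i)) u) *
        {a : (ℝ × ℝ) × ℝ | ε ≤ |a.2 - meanOn μ S Y a.1|}.indicator (fun _ => 1)
          ((orderStat (fun i => S (ω i)) l, orderStat (fun i => S (ω i)) u),
          ((∑ k ∈ Finset.Ioo l u, orderedLabel (fun i => S (ω i)) (fun i => Y (ω i)) k) / N))
        ∂(Measure.pi fun _ : Fin n => μ) ≤
    ENNReal.ofReal (2 * Real.exp (-2 * N * ε ^ 2)) *
      ∫⁻ ω, w (orderStat (fun i => S (ω i)) l, orderStat (fun i => S (ω i)) u)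
        ∂(Measure.pi fun _ : Fin n => μ) := by
  have hm : MeasurableSet {a : (ℝ × ℝ) × ℝ | ε ≤ |a.2 - meanOn μ S Y a.1|} := by
    have := measurable_meanOn (μ := μ) hS hY
    exact measurableSet_le measurable_const
      (continuous_abs.measurable.comp (measurable_snd.sub (this.comp measurable_fst)))
  refine lintegral_resample hS hY h0 h01 (by omega) (by omega) hun hN hw
    (φ := fun q a => {a : (ℝ × ℝ) × ℝ | ε ≤ |a.2 - meanOn μ S Y a.1|}.indicator (fun _ => 1)
      (q, a)) (measurable_const.indicator hm) fun hι s t => ?_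
  refine setLIntegral_mean_le (fun q a => {a : (ℝ × ℝ) × ℝ | ε ≤ |a.2 - meanOn μ S Y a.1|}.indicator
    (fun _ => 1) (q, a)) (by omega) hι fun hJ => ?_
  have := cond_isProbabilityMeasure hJ
  refine le_trans ?_ (measure_abs_mean_sub_ge_le (ν := μ[|S ⁻¹' Ioo s t]) hY hY01 (by omega) hι hε)
  rw [integral_cond_Ioo h0, ← lintegral_indicator_one]
  · rfl
  · exact measurableSet_le measurable_const (by fun_prop)

/-- Weighted mean square error of the mean label of a bin. -/
theorem lintegral_sq_error_le (hS : Measurable S) (hY : Measurable Y)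
    (hY01 : ∀ z, Y z ∈ Icc (0 : ℝ) 1) (h0 : ∀ c, μ {z | S z = c} = 0)
    (h01 : ∀ᵐ z ∂μ, S z ∈ Ioo (0 : ℝ) 1) (hlu : l + 1 < u) (hun : u ≤ n + 1)
    (hN : N = u - l - 1) {w : ℝ × ℝ → ENNReal} (hw : Measurable w) :
    ∫⁻ ω, w (orderStat (fun i => S (ω i)) l, orderStat (fun i => S (ω i)) u) *
        ENNReal.ofReal (((∑ k ∈ Finset.Ioo l u, orderedLabel (fun i => S (ω i))
          (fun i => Y (ω i)) k) / N - meanOn μ S Y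
            (orderStat (fun i => S (ω i)) l, orderStat (fun i => S (ω i)) u)) ^ 2)
        ∂(Measure.pi fun _ : Fin n => μ) ≤
    ENNReal.ofReal (1 / (4 * N)) *
      ∫⁻ ω, w (orderStat (fun i => S (ω i)) l, orderStat (fun i => S (ω i)) u)
        ∂(Measure.pi fun _ : Fin n => μ) := by
  have hmeas := measurable_meanOn (μ := μ) hS hY
  refine lintegral_resample hS hY h0 h01 (by omega) (by omega) hun hN hw
    (φ := fun q a => ENNReal.ofReal ((a - meanOn μ S Y q) ^ 2))
    (by fun_prop) fun hι s t => ?_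
  refine setLIntegral_mean_le (fun q a => ENNReal.ofReal ((a - meanOn μ S Y q) ^ 2))
    (by omega) hι fun hJ => ?_
  have := cond_isProbabilityMeasure hJ
  refine le_trans (le_of_eq ?_)
    (lintegral_sq_mean_sub_le (ν := μ[|S ⁻¹' Ioo s t]) hY hY01 (by omega) hι)
  rw [integral_cond_Ioo h0]

end Bins

/-! ### Regression function and calibration error of a piecewise constant predictor -/

section Predictor
variable {𝒳 : Type*} [MeasurableSpace 𝒳]

theorem measurable_label : Measurable (label : (𝒳 × I) × I → I) := by unfold label; fun_prop

theorem measurable_prediction {h : 𝒳 × I → ℝ} (hh : Measurable h) :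
    Measurable (prediction h) := by unfold prediction; fun_prop

theorem measurable_condMean (P : Measure (𝒳 × I)) [IsProbabilityMeasure P] (h : 𝒳 × I → ℝ) :
    Measurable (condMean P h) := by
  unfold condMean
  exact (StronglyMeasurable.integral_kernel
    (κ := condDistrib label (prediction h) (testLaw P)) (f := fun y : I => (y : ℝ))
    measurable_subtype_coe.stronglyMeasurable).measurable

variable {P : Measure (𝒳 × I)} [IsProbabilityMeasure P] {ι : Type*} {A : ι → Set ((𝒳 × I) × I)}

/-- A predictor with distinct values on the cells of a partition: its regression function at such a
value is the mean label on the cell. -/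
theorem condMean_of_partition {h : 𝒳 × I → ℝ} (hh : Measurable h) {v : ι → ℝ}
    (hv : Function.Injective v) (hA : ∀ b, MeasurableSet (A b))
    (hcov : ∀ᵐ z ∂testLaw P, ∃ b, z ∈ A b) (hval : ∀ b, ∀ z ∈ A b, prediction h z = v b) {b : ι}
    (hb : testLaw P (A b) ≠ 0) :
    condMean P h (v b) = (∫ z in A b, (label z : ℝ) ∂testLaw P) / (testLaw P).real (A b) := by
  have hp := measurable_prediction hh
  -- Distinct values make each level set a single cell, up to a null set.
  have hae : prediction h ⁻¹' {v b} =ᵐ[testLaw P] A b := by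
    filter_upwards [hcov] with z ⟨c, hc⟩
    refine propext (show prediction h z = v b ↔ z ∈ A b from ⟨fun hz => ?_, hval b z⟩)
    rw [hval c z hc] at hz
    rwa [← hv hz]
  have hmap : (testLaw P).map (prediction h) {v b} = testLaw P (A b) := by
    rw [Measure.map_apply hp (measurableSet_singleton _), measure_congr hae]
  have hcd : condDistrib label (prediction h) (testLaw P) (v b) =
      ((testLaw P)[|A b]).map label := by
    ext s hs
    rw [condDistrib_apply_of_ne_zero measurable_label _ (by rwa [hmap]), hmap,
      Measure.map_apply (hp.prodMk measurable_label) ((measurableSet_singleton _).prod hs),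
      Measure.map_apply measurable_label hs, cond_apply (hA b)]
    congr 1
    refine measure_congr ?_
    exact hae.inter (ae_eq_refl (label ⁻¹' s))
  rw [condMean, hcd, integral_map measurable_label.aemeasurable
    measurable_subtype_coe.aestronglyMeasurable, ProbabilityTheory.cond, integral_smul_measure,
    ENNReal.toReal_inv, smul_eq_mul, div_eq_inv_mul]
  rfl

/-- `F` is only prescribed on cells of positive mass, because `condMean` is controlled only there.
-/
theorem integral_of_partition [Fintype ι] {Z : Type*} [MeasurableSpace Z] {μ : Measure Z}
    [IsProbabilityMeasure μ] {A : ι → Set Z} (hA : ∀ b, MeasurableSet (A b))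
    (hd : Pairwise (Function.onFun Disjoint A)) (hcov : ∀ᵐ z ∂μ, ∃ b, z ∈ A b)
    {F : Z → ℝ} {f : ι → ℝ} (hF : ∀ b, μ (A b) ≠ 0 → ∀ z ∈ A b, F z = f b) :
    ∫ z, F z ∂μ = ∑ b, μ.real (A b) * f b := by
  have hnull : ∀ᵐ z ∂μ, ∀ b, z ∈ A b → μ (A b) ≠ 0 := by
    rw [ae_all_iff]
    intro b
    by_cases h : μ (A b) = 0
    · filter_upwards [compl_mem_ae_iff.2 h] with z hz hz'
      exact absurd hz' hz
    · exact ae_of_all _ fun _ _ => h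
  have : F =ᵐ[μ] fun z => ∑ b, (A b).indicator (fun _ => f b) z := by
    filter_upwards [hcov, hnull] with z ⟨b, hb⟩ hz
    rw [Finset.sum_eq_single b, indicator_of_mem hb, hF b (hz b hb) z hb]
    · intro c _ hc
      exact indicator_of_notMem (fun h => (hd hc).le_bot ⟨h, hb⟩) _
    · simp
  rw [integral_congr_ae this, integral_finsetSum _ fun b _ =>
    (integrable_const _).indicator (hA b)]
  exact Finset.sum_congr rfl fun b _ => by rw [integral_indicator_const _ (hA b), smul_eq_mul]

theorem sum_measureReal_of_partition [Fintype ι] {Z : Type*} [MeasurableSpace Z] {μ : Measure Z}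
    [IsProbabilityMeasure μ] {A : ι → Set Z} (hA : ∀ b, MeasurableSet (A b))
    (hd : Pairwise (Function.onFun Disjoint A)) (hcov : ∀ᵐ z ∂μ, ∃ b, z ∈ A b) :
    ∑ b, μ.real (A b) = 1 := by
  have := integral_of_partition hA hd hcov (F := fun _ => 1) (f := fun _ => 1) (by simp)
  simpa using this.symm

theorem UniformlyCalibrated.ece_le {h : 𝒳 × I → ℝ} (hh : Measurable h) {ε : ℝ} (hε : 0 ≤ ε)
    (H : UniformlyCalibrated P h ε) {p : ℝ} (hp : 1 ≤ p) : ece P h p ≤ ε := by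
  have h1 := ae_of_ae_map (measurable_prediction hh).aemeasurable H
  have hp0 : 0 < p := by linarith
  have h2 : ∫ ω, |condMean P h (prediction h ω) - prediction h ω| ^ p ∂testLaw P ≤ ε ^ p := by
    calc _ ≤ ∫ ω, ε ^ p ∂testLaw P := by
          refine integral_mono_of_nonneg (ae_of_all _ fun ω => by positivity)
            (integrable_const _) ?_
          filter_upwards [h1] with ω hω
          exact Real.rpow_le_rpow (abs_nonneg _) hω hp0.le
      _ = _ := by simp
  calc ece P h p ≤ (ε ^ p) ^ (1 / p) :=
        Real.rpow_le_rpow (integral_nonneg fun ω => by positivity) h2 (by positivity)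
    _ = ε := by rw [← Real.rpow_mul hε, mul_one_div_cancel hp0.ne', Real.rpow_one]

end Predictor

/-- Minkowski's inequality and the monotonicity of `ℓ_p` norms for a finite weighted sum. -/
theorem weighted_rpow_le_sqrt_add {ι : Type*} [Fintype ι] {w d e : ι → ℝ} {δ : ℝ} (hδ : 0 ≤ δ)
    (hw : ∀ b, 0 ≤ w b) (hw1 : ∑ b, w b = 1) (hd : ∀ b, 0 ≤ d b) (hde : ∀ b, d b ≤ e b + δ)
    (he : ∀ b, 0 ≤ e b) {p : ℝ} (hp : 1 ≤ p) (hp2 : p ≤ 2) :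
    (∑ b, w b * d b ^ p) ^ (1 / p) ≤ √(∑ b, w b * e b ^ 2) + δ := by
  have hp0 : 0 < p := by linarith
  set q := ∑ b, w b * e b ^ 2 with hq
  have hq0 : 0 ≤ q := Finset.sum_nonneg fun b _ => mul_nonneg (hw b) (sq_nonneg _)
  have hs0 : 0 ≤ ∑ b, w b * d b ^ p :=
    Finset.sum_nonneg fun b _ => mul_nonneg (hw b) (Real.rpow_nonneg (hd b) _)
  -- Jensen for the exponent `2 / p ≥ 1`; this is where `p ≤ 2` enters.
  have h1 : (∑ b, w b * d b ^ p) ^ (2 / p) ≤ ∑ b, w b * d b ^ 2 := by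
    refine (Real.rpow_arith_mean_le_arith_mean_rpow Finset.univ w (fun b => d b ^ p)
      (fun b _ => hw b) hw1 (fun b _ => Real.rpow_nonneg (hd b) _)
      ((one_le_div hp0).2 hp2)).trans (le_of_eq ?_)
    refine Finset.sum_congr rfl fun b _ => ?_
    rw [← Real.rpow_mul (hd b), mul_div_cancel₀ _ hp0.ne', Real.rpow_two]
  have h2 : ((∑ b, w b * d b ^ p) ^ (1 / p)) ^ 2 = (∑ b, w b * d b ^ p) ^ (2 / p) := by
    rw [← Real.rpow_two, ← Real.rpow_mul hs0]
    congr 1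
    ring
  have h3 : ∑ b, w b * e b ≤ √q := by
    refine Real.le_sqrt_of_sq_le ?_
    exact Real.pow_arith_mean_le_arith_mean_pow Finset.univ w e (fun b _ => hw b) hw1
      (fun b _ => he b) 2
  have h4 : ∑ b, w b * d b ^ 2 ≤ (√q + δ) ^ 2 := by
    calc _ ≤ ∑ b, w b * (e b + δ) ^ 2 := Finset.sum_le_sum fun b _ =>
          mul_le_mul_of_nonneg_left (pow_le_pow_left₀ (hd b) (hde b) 2) (hw b)
      _ = q + 2 * δ * ∑ b, w b * e b + δ ^ 2 * ∑ b, w b := by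
          rw [hq, Finset.mul_sum, Finset.mul_sum, ← Finset.sum_add_distrib,
            ← Finset.sum_add_distrib]
          exact Finset.sum_congr rfl fun b _ => by ring
      _ ≤ q + 2 * δ * √q + δ ^ 2 * 1 := by rw [hw1]; gcongr
      _ = (√q + δ) ^ 2 := by rw [add_sq, Real.sq_sqrt hq0]; ring
  exact le_of_sq_le_sq (h2 ▸ h1.trans h4) (by positivity)

/-! ### Boundary indices -/

section Boundary

theorem boundary_zero (n B : ℕ) : boundary n B 0 = 0 := by simp [boundary]

theorem boundary_self {n B : ℕ} (hB : 1 ≤ B) : boundary n B B = n + 1 := by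
  unfold boundary
  have : (B : ℝ) ≠ 0 := by positivity
  rw [mul_div_cancel₀ _ this]
  exact_mod_cast Nat.ceil_natCast (n + 1)

/-- The real spacing `(n + 1)/B` is at least the integer `⌊n/B⌋`, and an integer passes through the
ceiling. -/
theorem boundary_add_div_le {n B : ℕ} (b : ℕ) :
    boundary n B b + n / B ≤ boundary n B (b + 1) := by
  unfold boundary
  rw [← Nat.ceil_add_natCast (by positivity)]
  refine Nat.ceil_le_ceil ?_
  push_cast
  have h1 : ((n / B : ℕ) : ℝ) ≤ (n : ℝ) / B := Nat.cast_div_le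
  have h2 : (n : ℝ) / B ≤ ((n : ℝ) + 1) / B := by gcongr; linarith
  linarith

theorem boundary_mono {n B : ℕ} : Monotone (boundary n B) :=
  monotone_nat_of_le_succ fun b => (Nat.le_add_right _ _).trans (boundary_add_div_le b)

theorem boundary_le {n B b : ℕ} (hb : b ≤ B) (hB : 1 ≤ B) : boundary n B b ≤ n + 1 :=
  (boundary_mono hb).trans_eq (boundary_self hB)

theorem two_le_div {n B : ℕ} (hB : 1 ≤ B) (hn : 2 * B ≤ n) : 2 ≤ n / B :=
  (Nat.le_div_iff_mul_le hB).2 hn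

end Boundary

/-! ### The perturbation and the law of the score -/

theorem perturb_mem_Icc {δ t u : ℝ} (hδ : 0 < δ) (ht : t ∈ Icc (0 : ℝ) 1)
    (hu : u ∈ Icc (0 : ℝ) 1) : perturb δ t u ∈ Icc (0 : ℝ) 1 := by
  have h : 0 < 1 + δ := by linarith
  have h1 := mul_nonneg hδ.le hu.1
  have h2 := mul_le_mul_of_nonneg_left hu.2 hδ.le
  unfold perturb
  rw [mem_Icc, inv_mul_eq_div, le_div_iff₀ h, div_le_iff₀ h]
  constructor <;> linarith [ht.1, ht.2]

/-- The difference is `δ/(1 + δ) · (t - u)`; this is the price of randomizing the output. -/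
theorem abs_sub_perturb_le {δ t u : ℝ} (hδ : 0 < δ) (ht : t ∈ Icc (0 : ℝ) 1)
    (hu : u ∈ Icc (0 : ℝ) 1) : |t - perturb δ t u| ≤ δ := by
  have h : 0 < 1 + δ := by linarith
  have e : t - perturb δ t u = δ / (1 + δ) * (t - u) := by
    unfold perturb
    field_simp
    ring
  have h1 : |t - u| ≤ 1 := abs_le.2 ⟨by linarith [ht.1, hu.2], by linarith [ht.2, hu.1]⟩
  rw [e, abs_mul, abs_of_pos (by positivity)]
  calc δ / (1 + δ) * |t - u| ≤ δ / (1 + δ) * 1 := by gcongr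
    _ ≤ δ := by rw [mul_one]; exact div_le_self hδ.le (by linarith)

theorem perturb_eq_iff {δ t t' u u' : ℝ} (hδ : 0 < δ) :
    perturb δ t u = perturb δ t' u' ↔ u = u' + (t' - t) / δ := by
  have h : (1 + δ)⁻¹ ≠ 0 := by positivity
  unfold perturb
  rw [mul_right_inj' h]
  field_simp
  constructor <;> intro h <;> linarith

/-- The perturbed score of a test triple. -/
def testScore {𝒳 : Type*} (δ : ℝ) (g : 𝒳 → I) (z : (𝒳 × I) × I) : ℝ := perturb δ (g z.1.1) z.2

section Score
variable {𝒳 : Type*} [MeasurableSpace 𝒳]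

variable {δ : ℝ} {g : 𝒳 → I} {P : Measure (𝒳 × I)}

theorem measurable_testScore (hg : Measurable g) : Measurable (testScore δ g) := by
  unfold testScore perturb
  fun_prop

/-- For a fixed feature at most one noise value `u` produces the score `c`, whatever `g` and `P`
are. -/
theorem testScore_eq_null (hδ : 0 < δ) (hg : Measurable g) (c : ℝ) :
    testLaw P {z | testScore δ g z = c} = 0 := by
  have hs : MeasurableSet {z | testScore δ g z = c} :=
    measurableSet_eq_fun (measurable_testScore hg) measurable_const
  rw [testLaw, Measure.measure_prod_null hs]
  refine ae_of_all _ fun x => Set.Subsingleton.measure_zero (fun u hu u' hu' => ?_) _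
  have h : perturb δ (g x.1) u = perturb δ (g x.1) u' :=
    (show testScore δ g (x, u) = c from hu).trans (show testScore δ g (x, u') = c from hu').symm
  rw [perturb_eq_iff hδ] at h
  exact Subtype.ext (by simpa using h)

theorem ae_testScore_mem_Ioo (hδ : 0 < δ) (hg : Measurable g) :
    ∀ᵐ z ∂testLaw P, testScore δ g z ∈ Ioo (0 : ℝ) 1 := by
  filter_upwards [compl_mem_ae_iff.2 (testScore_eq_null (P := P) hδ hg 0),
    compl_mem_ae_iff.2 (testScore_eq_null (P := P) hδ hg 1)] with z h0 h1
  have h := perturb_mem_Icc hδ (g z.1.1).2 z.2.2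
  exact ⟨lt_of_le_of_ne h.1 (Ne.symm h0), lt_of_le_of_ne h.2 h1⟩

end Score

/-! ### The predictor as a function constant on bins -/

section Bin
variable {𝒳 : Type*} {n B : ℕ} {δ : ℝ} {g : 𝒳 → I}

/-- The score boundary with number `b`. -/
def binBoundary (B : ℕ) (δ : ℝ) (g : 𝒳 → I) (ω : Fin n → (𝒳 × I) × I) (b : ℕ) : ℝ :=
  orderStat (fun i => testScore δ g (ω i)) (boundary n B b)

/-- The mean label of a bin over the sample. -/
def binAvg (B : ℕ) (δ : ℝ) (g : 𝒳 → I) (ω : Fin n → (𝒳 × I) × I) (b : ℕ) : ℝ :=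
  binMean B (fun i => testScore δ g (ω i)) (fun i => (label (ω i) : ℝ)) b

/-- The number of calibration points inside a bin. -/
def binCount (n B b : ℕ) : ℕ := boundary n B (b + 1) - boundary n B b - 1

theorem div_le_binCount_add_one (n B b : ℕ) : n / B ≤ binCount n B b + 1 := by
  have := boundary_add_div_le (n := n) (B := B) b
  unfold binCount
  omega

theorem binBoundary_mono (hδ : 0 < δ) (ω : Fin n → (𝒳 × I) × I) :
    Monotone (binBoundary B δ g ω) :=
  (orderStat_mono fun i => perturb_mem_Icc hδ (g (ω i).1.1).2 (ω i).2.2).comp boundary_mono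

theorem binAvg_mem_Icc (ω : Fin n → (𝒳 × I) × I) (b : ℕ) :
    binAvg B δ g ω b ∈ Icc (0 : ℝ) 1 := by
  have h := fun k => orderedLabel_mem_Icc (fun i => testScore δ g (ω i))
    (Y := fun i => (label (ω i) : ℝ)) (fun i => (label (ω i)).2) k
  unfold binAvg binMean
  constructor
  · exact div_nonneg (Finset.sum_nonneg fun k _ => (h k).1) (Nat.cast_nonneg _)
  · refine div_le_one_of_le₀ ?_ (Nat.cast_nonneg _)
    calc _ ≤ ∑ k ∈ Finset.Ioo (boundary n B b) (boundary n B (b + 1)), (1 : ℝ) :=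
          Finset.sum_le_sum fun k _ => (h k).2
      _ = _ := by simp

theorem binAvg_eq (ω : Fin n → (𝒳 × I) × I) (b : ℕ) :
    binAvg B δ g ω b = (∑ k ∈ Finset.Ioo (boundary n B b) (boundary n B (b + 1)),
      orderedLabel (fun i => testScore δ g (ω i)) (fun i => (label (ω i) : ℝ)) k) /
        (binCount n B b : ℝ) := by
  rw [binAvg, binMean, Nat.card_Ioo, binCount]

/-- Calibration data joined with the noise of the calibration scores. -/
def joinNoise (τ : (Fin n → 𝒳 × I) × Seed n B) (i : Fin n) : (𝒳 × I) × I := (τ.1 i, τ.2.1 i)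

/-- The bins, as subsets of the space of test triples. -/
def bin (B : ℕ) (δ : ℝ) (g : 𝒳 → I) (ω : Fin n → (𝒳 × I) × I) (b : ℕ) : Set ((𝒳 × I) × I) :=
  testScore δ g ⁻¹' Ico (binBoundary B δ g ω b) (binBoundary B δ g ω (b + 1))

/-- The values of the predictor on the bins. -/
def binValue (B : ℕ) (δ : ℝ) (g : 𝒳 → I) (τ : (Fin n → 𝒳 × I) × Seed n B) (b : Fin B) : ℝ :=
  perturb δ (binAvg B δ g (joinNoise τ) b) (τ.2.2 b)

open Classical in
theorem prediction_umd (τ : (Fin n → 𝒳 × I) × Seed n B) (z : (𝒳 × I) × I) :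
    prediction (umd B δ g τ.1 τ.2) z =
      ∑ b : Fin B, if z ∈ bin B δ g (joinNoise τ) b then binValue B δ g τ b else 0 := by
  unfold prediction umd
  exact Finset.sum_congr rfl fun b _ => if_congr Iff.rfl rfl rfl

theorem pairwise_disjoint_bin (hδ : 0 < δ) (ω : Fin n → (𝒳 × I) × I) :
    Pairwise (Function.onFun Disjoint fun b : Fin B => bin B δ g ω b) := by
  have h := (binBoundary_mono (B := B) (g := g) hδ ω).pairwise_disjoint_on_Ico_succ
  intro b c hbc
  exact (h fun hc => hbc (Fin.ext hc)).preimage _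

theorem prediction_umd_of_mem (hδ : 0 < δ) (τ : (Fin n → 𝒳 × I) × Seed n B) (b : Fin B) :
    ∀ z ∈ bin B δ g (joinNoise τ) b,
      prediction (umd B δ g τ.1 τ.2) z = binValue B δ g τ b := by
  intro z hz
  classical
  rw [prediction_umd, Finset.sum_eq_single b, if_pos hz]
  · intro c _ hc
    exact if_neg fun h => (pairwise_disjoint_bin hδ _ hc).le_bot ⟨h, hz⟩
  · simp

end Bin

/-! ### The law of the calibration sample and the errors in a bin -/

section Sample
variable {𝒳 : Type*} [MeasurableSpace 𝒳] {n B : ℕ}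

theorem measurable_joinNoise : Measurable (joinNoise (𝒳 := 𝒳) (n := n) (B := B)) := by
  unfold joinNoise; fun_prop

instance : IsProbabilityMeasure (seedLaw n B) := by unfold seedLaw; infer_instance

instance (P : Measure (𝒳 × I)) [IsProbabilityMeasure P] :
    IsProbabilityMeasure (trainLaw n P (seedLaw n B)) := by unfold trainLaw; infer_instance

/-- Discarding `V` and pairing each point with its own noise yields independent points with the law
of a test triple, as resampling and exchangeability need. -/
theorem measurePreserving_joinNoise (P : Measure (𝒳 × I)) [IsProbabilityMeasure P] :
    MeasurePreserving (joinNoise (n := n) (B := B)) (trainLaw n P (seedLaw n B))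
      (Measure.pi fun _ => testLaw P) := by
  have h1 : MeasurePreserving (Prod.map id Prod.fst) (trainLaw n P (seedLaw n B))
      ((Measure.pi fun _ : Fin n => P).prod (Measure.pi fun _ : Fin n => (volume : Measure I))) :=
    (MeasurePreserving.id _).prod measurePreserving_fst
  exact (measurePreserving_arrowProdEquivProdArrow (𝒳 × I) I (Fin n) (fun _ => P)
    fun _ => volume).symm.comp h1

/-- The mean label of a bin under the law of a test triple. -/
def binTarget (P : Measure (𝒳 × I)) (B : ℕ) (δ : ℝ) (g : 𝒳 → I) (ω : Fin n → (𝒳 × I) × I)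
    (b : ℕ) : ℝ :=
  meanOn (testLaw P) (testScore δ g) (fun z => (label z : ℝ))
    (binBoundary B δ g ω b, binBoundary B δ g ω (b + 1))

variable {δ : ℝ} {g : 𝒳 → I} {P : Measure (𝒳 × I)} [IsProbabilityMeasure P]

theorem measurableSet_bin (hg : Measurable g) (ω : Fin n → (𝒳 × I) × I) (b : ℕ) :
    MeasurableSet (bin B δ g ω b) := measurableSet_Ico.preimage (measurable_testScore hg)

theorem ae_mem_bin {P : Measure (𝒳 × I)} (hB : 1 ≤ B) (hδ : 0 < δ) (hg : Measurable g) (ω : Fin n → (𝒳 × I) × I) :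
    ∀ᵐ z ∂testLaw P, ∃ b : Fin B, z ∈ bin B δ g ω b := by
  filter_upwards [ae_testScore_mem_Ioo hδ hg] with z hz
  by_contra! hno
  -- A score in no bin would pass every boundary in turn, including the last one, which is `1`.
  have key : ∀ b ≤ B, binBoundary B δ g ω b ≤ testScore δ g z := by
    intro b
    induction b with
    | zero =>
      intro _
      rw [binBoundary, boundary_zero, orderStat_zero]
      exact hz.1.le
    | succ b ih =>
      intro hb
      by_contra! hlt
      exact hno ⟨b, hb⟩ ⟨ih (by omega), hlt⟩
  have := key B le_rfl
  rw [binBoundary, boundary_self hB, orderStat_of_lt _ (Nat.lt_succ_self n)] at this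
  exact this.not_gt hz.2

theorem measurable_umd (hg : Measurable g) (D : Fin n → 𝒳 × I) (θ : Seed n B) :
    Measurable (umd B δ g D θ) := by
  have h : Measurable fun z : 𝒳 × I => perturb δ (g z.1) z.2 := by
    unfold perturb; fun_prop
  unfold umd
  refine Finset.measurable_sum _ fun b _ => Measurable.ite ?_ measurable_const measurable_const
  exact (measurableSet_le measurable_const h).inter (measurableSet_lt h measurable_const)

theorem condMean_umd (hB : 1 ≤ B) (hδ : 0 < δ) (hg : Measurable g)
    {τ : (Fin n → 𝒳 × I) × Seed n B} (hτ : Function.Injective (binValue B δ g τ)) {b : Fin B}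
    (hb : testLaw P (bin B δ g (joinNoise τ) b) ≠ 0) :
    condMean P (umd B δ g τ.1 τ.2) (binValue B δ g τ b) = binTarget P B δ g (joinNoise τ) b :=
  condMean_of_partition (measurable_umd hg _ _) hτ (fun b => measurableSet_bin hg _ b)
    (ae_mem_bin hB hδ hg _) (prediction_umd_of_mem hδ τ) hb

/-- On a bin of positive mass, the calibration error is at most the error of the mean label plus
`δ`. -/
theorem abs_target_sub_value_le {P : Measure (𝒳 × I)} (hδ : 0 < δ) (τ : (Fin n → 𝒳 × I) × Seed n B) (b : Fin B) :
    |binTarget P B δ g (joinNoise τ) b - binValue B δ g τ b| ≤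
      |binAvg B δ g (joinNoise τ) b - binTarget P B δ g (joinNoise τ) b| + δ := by
  have h := abs_sub_perturb_le hδ (binAvg_mem_Icc (B := B) (δ := δ) (g := g) (joinNoise τ) b)
    (τ.2.2 b).2
  calc _ ≤ |binTarget P B δ g (joinNoise τ) b - binAvg B δ g (joinNoise τ) b| +
        |binAvg B δ g (joinNoise τ) b - binValue B δ g τ b| := abs_sub_le _ _ _
    _ ≤ _ := by rw [abs_sub_comm (binTarget P B δ g (joinNoise τ) b)]; gcongr; exact h

theorem measurable_binBoundary (hg : Measurable g) (b : ℕ) :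
    Measurable fun ω : Fin n → (𝒳 × I) × I => binBoundary B δ g ω b := by
  have := measurable_testScore (δ := δ) hg
  exact (measurable_orderStat _).comp (f := fun (ω : Fin n → (𝒳 × I) × I) i => testScore δ g (ω i))
    (by fun_prop)

theorem measurable_binAvg (hg : Measurable g) (b : ℕ) :
    Measurable fun ω : Fin n → (𝒳 × I) × I => binAvg B δ g ω b := by
  have := measurable_testScore (δ := δ) hg
  have hl := measurable_label (𝒳 := 𝒳)
  unfold binAvg binMean
  refine Measurable.div_const (Finset.measurable_sum _ fun k _ => ?_) _
  exact (measurable_orderedLabel k).comp (f := fun (ω : Fin n → (𝒳 × I) × I) =>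
    ((fun i => testScore δ g (ω i)), fun i => (label (ω i) : ℝ))) (by fun_prop)

theorem measurable_label_real : Measurable fun z : (𝒳 × I) × I => (label z : ℝ) :=
  measurable_subtype_coe.comp measurable_label

theorem measurable_binTarget (hg : Measurable g) (b : ℕ) :
    Measurable fun ω : Fin n → (𝒳 × I) × I => binTarget P B δ g ω b :=
  (measurable_meanOn (measurable_testScore hg) measurable_label_real).comp
    ((measurable_binBoundary hg b).prodMk (measurable_binBoundary hg (b + 1)))

theorem measurable_binMass (hg : Measurable g) (b : ℕ) :
    Measurable fun ω : Fin n → (𝒳 × I) × I => testLaw P (bin B δ g ω b) :=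
  (measurable_measure_Ico (measurable_testScore hg)).comp
    ((measurable_binBoundary hg b).prodMk (measurable_binBoundary hg (b + 1)))

theorem measurable_binValue (hg : Measurable g) (b : Fin B) :
    Measurable fun τ : (Fin n → 𝒳 × I) × Seed n B => binValue B δ g τ b := by
  have := (measurable_binAvg (B := B) (δ := δ) hg b).comp
    (measurable_joinNoise (𝒳 := 𝒳) (n := n) (B := B))
  have h2 : Measurable fun τ : (Fin n → 𝒳 × I) × Seed n B => ((τ.2.2 b : I) : ℝ) := by fun_prop
  unfold binValue perturb
  exact (this.add (h2.const_mul δ)).const_mul _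

/-- Given the data and `U`, the bin averages are constants, so two equal values force `V_b - V_c` to
be a prescribed number. -/
theorem ae_injective_binValue {P : Measure (𝒳 × I)} (hδ : 0 < δ) (hg : Measurable g) :
    ∀ᵐ τ ∂trainLaw n P (seedLaw n B), Function.Injective (binValue B δ g τ) := by
  have key : ∀ᵐ τ ∂trainLaw n P (seedLaw n B), ∀ b c : Fin B, b ≠ c →
      binValue B δ g τ b ≠ binValue B δ g τ c := by
    rw [ae_all_iff]; intro b
    rw [ae_all_iff]; intro c
    by_cases hbc : b = c
    · simp [hbc]
    have hm : MeasurableSet {τ : (Fin n → 𝒳 × I) × Seed n B |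
        binValue B δ g τ b ≠ binValue B δ g τ c} :=
      (measurableSet_eq_fun (measurable_binValue hg b) (measurable_binValue hg c)).compl
    have h : ∀ᵐ τ ∂trainLaw n P (seedLaw n B), binValue B δ g τ b ≠ binValue B δ g τ c := by
      refine (Measure.ae_prod_iff_ae_ae hm).2 (ae_of_all _ fun D =>
        (Measure.ae_prod_iff_ae_ae (hm.preimage measurable_prodMk_left)).2
          (ae_of_all _ fun U => ?_))
      have hnull := pi_eq_add_const_null (μ := (volume : Measure I)) (f := fun v : I => (v : ℝ))
        measurable_subtype_coe (fun r => Set.Subsingleton.measure_zero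
          (fun u hu u' hu' => Subtype.ext (Eq.trans hu (Eq.symm hu'))) _) hbc
        ((binAvg B δ g (fun i => (D i, U i)) c - binAvg B δ g (fun i => (D i, U i)) b) / δ)
      filter_upwards [compl_mem_ae_iff.2 hnull] with V hV hc
      exact hV ((perturb_eq_iff hδ).1 hc)
    filter_upwards [h] with τ hτ _
    exact hτ
  filter_upwards [key] with τ hτ
  exact fun b c hbc => by_contra fun hne => hτ b c hne hbc

/-- The mean label over the sample deviates by at least `ε` from the one under the test law. -/
def deviationSet (P : Measure (𝒳 × I)) (B : ℕ) (δ : ℝ) (g : 𝒳 → I) (ε : ℝ) (b : ℕ) :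
    Set (Fin n → (𝒳 × I) × I) :=
  {ω | ε ≤ |binAvg B δ g ω b - binTarget P B δ g ω b|}

theorem measurableSet_deviationSet (hg : Measurable g) (ε : ℝ) (b : ℕ) :
    MeasurableSet (deviationSet (n := n) P B δ g ε b) :=
  measurableSet_le measurable_const (continuous_abs.measurable.comp
    ((measurable_binAvg hg b).sub (measurable_binTarget hg b)))

theorem setLIntegral_deviationSet_le (hB : 1 ≤ B) (hn : 2 * B ≤ n) (hδ : 0 < δ)
    (hg : Measurable g) {w : ℝ × ℝ → ENNReal} (hw : Measurable w) {ε : ℝ}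
    (hε : 0 ≤ ε) (b : Fin B) :
    ∫⁻ ω in deviationSet (n := n) P B δ g ε b,
        w (binBoundary B δ g ω b, binBoundary B δ g ω (b + 1))
        ∂(Measure.pi fun _ => testLaw P) ≤
      ENNReal.ofReal (2 * Real.exp (-2 * binCount n B b * ε ^ 2)) *
        ∫⁻ ω : Fin n → (𝒳 × I) × I, w (binBoundary B δ g ω b, binBoundary B δ g ω (b + 1))
          ∂(Measure.pi fun _ => testLaw P) := by
  -- Boundary indices are at least two apart, so every bin contains a calibration point.
  have h2 := two_le_div hB hn
  have h3 := boundary_add_div_le (n := n) (B := B) b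
  refine le_of_eq_of_le ?_ (lintegral_deviation_le (μ := testLaw P) (S := testScore δ g)
    (Y := fun z => (label z : ℝ)) (measurable_testScore hg) measurable_label_real
    (fun z => (label z).2) (testScore_eq_null hδ hg) (ae_testScore_mem_Ioo hδ hg)
    (l := boundary n B b) (u := boundary n B (b + 1)) (N := binCount n B b) (by omega)
    (boundary_le b.2 hB) rfl hw hε)
  rw [← lintegral_indicator (measurableSet_deviationSet hg ε b)]
  refine lintegral_congr fun ω => ?_
  simp only [indicator, mem_ofPred_eq, deviationSet, binAvg_eq, binTarget, binBoundary, mul_ite,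
    mul_one, mul_zero]

theorem lintegral_binMass_le (hδ : 0 < δ) (hg : Measurable g) (b : Fin B) :
    ∫⁻ ω : Fin n → (𝒳 × I) × I, testLaw P (bin B δ g ω b) ∂(Measure.pi fun _ => testLaw P) ≤
      ((boundary n B (b + 1) - boundary n B b : ℕ) : ENNReal) / (n + 1 : ℕ) :=
  lintegral_mass_le (measurable_testScore hg) (testScore_eq_null hδ hg)
    (ae_testScore_mem_Ioo hδ hg) _ _

/-- The variance bound `1/(4N)` multiplies the expected mass, at most `(N + 1)/(n + 1)`; since `N ≥
1`, the ratio `(N + 1)/N` is at most `2`. -/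
theorem lintegral_sq_error_bin_le (hB : 1 ≤ B) (hn : 2 * B ≤ n) (hδ : 0 < δ)
    (hg : Measurable g) (b : Fin B) :
    ∫⁻ ω : Fin n → (𝒳 × I) × I, testLaw P (bin B δ g ω b) *
        ENNReal.ofReal ((binAvg B δ g ω b - binTarget P B δ g ω b) ^ 2)
        ∂(Measure.pi fun _ => testLaw P) ≤ ENNReal.ofReal (1 / (2 * n)) := by
  have h2 := two_le_div hB hn
  have h3 := boundary_add_div_le (n := n) (B := B) b
  have h := lintegral_sq_error_le (μ := testLaw P) (S := testScore δ g) (n := n)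
    (Y := fun z => (label z : ℝ)) (measurable_testScore hg) measurable_label_real
    (fun z => (label z).2) (testScore_eq_null hδ hg) (ae_testScore_mem_Ioo hδ hg)
    (l := boundary n B b) (u := boundary n B (b + 1)) (N := binCount n B b) (by omega)
    (boundary_le b.2 hB) rfl
    (w := fun q => testLaw P {z | testScore δ g z ∈ Ico q.1 q.2})
    (measurable_measure_Ico (measurable_testScore hg))
  have hc : boundary n B (b + 1) - boundary n B b = binCount n B b + 1 := by
    unfold binCount; omega
  have hc1 : 1 ≤ binCount n B b := by unfold binCount; omega
  have hc1' : (1 : ℝ) ≤ binCount n B b := by exact_mod_cast hc1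
  have hn0 : (0 : ℝ) < n := by
    have : 0 < n := by omega
    exact_mod_cast this
  calc _ = _ := by
        refine lintegral_congr fun ω => ?_
        rw [binAvg_eq]
        rfl
    _ ≤ _ := h
    _ ≤ ENNReal.ofReal (1 / (4 * binCount n B b)) *
        (((boundary n B (b + 1) - boundary n B b : ℕ) : ENNReal) / (n + 1 : ℕ)) :=
      mul_le_mul_right (lintegral_binMass_le hδ hg b) _
    _ = ENNReal.ofReal (1 / (4 * binCount n B b) * ((binCount n B b + 1) / (n + 1))) := by
      rw [ENNReal.ofReal_mul (by positivity), hc, ← Nat.cast_add_one, ← Nat.cast_add_one,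
        ENNReal.ofReal_div_of_pos (x := ((binCount n B b + 1 : ℕ) : ℝ)) (by positivity),
        ENNReal.ofReal_natCast, ENNReal.ofReal_natCast]
    _ ≤ _ := by
      refine ENNReal.ofReal_le_ofReal ?_
      rw [div_mul_div_comm, one_mul, div_le_div_iff₀ (by positivity) (by positivity)]
      nlinarith [mul_nonneg hn0.le (sub_nonneg.2 hc1')]

end Sample

/-! ### Marginal and conditional calibration -/

section Calibrated
variable {𝒳 : Type*} [MeasurableSpace 𝒳] {n B : ℕ} {δ : ℝ}

/-- `K` is the number of events in the union bound: `1` for marginal and `B` for conditional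
calibration. -/
theorem two_mul_exp_le (hB : 1 ≤ B) (hn : 2 * B ≤ n) {α K : ℝ} (hα : 0 < α) (hα1 : α < 1)
    (hK : 1 ≤ K) (b : ℕ) :
    2 * Real.exp (-2 * binCount n B b *
      √(Real.log (2 * K / α) / (2 * ((⌊(n : ℝ) / (B : ℝ)⌋₊ : ℝ) - 1))) ^ 2) ≤ α / K := by
  have h2 : (2 : ℝ) ≤ (n / B : ℕ) := by exact_mod_cast two_le_div hB hn
  have hc : ((n / B : ℕ) : ℝ) ≤ binCount n B b + 1 := by
    exact_mod_cast div_le_binCount_add_one n B b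
  have hx : 1 ≤ 2 * K / α := by rw [one_le_div hα]; linarith
  have hlog : 0 ≤ Real.log (2 * K / α) := Real.log_nonneg hx
  rw [Nat.floor_div_eq_div, Real.sq_sqrt (div_nonneg hlog (by linarith))]
  have h3 : Real.log (2 * K / α) ≤ 2 * binCount n B b *
      (Real.log (2 * K / α) / (2 * (((n / B : ℕ) : ℝ) - 1))) := by
    have hpos : 0 < 2 * (((n / B : ℕ) : ℝ) - 1) := by linarith
    rw [mul_div_assoc', le_div_iff₀ hpos, mul_comm]
    exact mul_le_mul_of_nonneg_right (by linarith) hlog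
  calc _ ≤ 2 * Real.exp (-Real.log (2 * K / α)) := by
        gcongr
        linarith
    _ = α / K := by
        rw [Real.exp_neg, Real.exp_log (by linarith)]
        field_simp

theorem sum_boundary_sub (hB : 1 ≤ B) :
    ∑ b : Fin B, ((boundary n B (b + 1) - boundary n B b : ℕ) : ENNReal) / (n + 1 : ℕ) = 1 := by
  rw [← Finset.sum_range
    (fun b => ((boundary n B (b + 1) - boundary n B b : ℕ) : ENNReal) / (n + 1 : ℕ))]
  simp_rw [div_eq_mul_inv]
  rw [← Finset.sum_mul, ← Nat.cast_sum, Finset.sum_range_tsub boundary_mono, boundary_zero,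
    boundary_self hB, Nat.sub_zero, ENNReal.mul_inv_cancel (by simp) (by simp)]

theorem ae_mem_bin_and_ne_zero {P : Measure (𝒳 × I)} {g : 𝒳 → I} (hB : 1 ≤ B) (hδ : 0 < δ)
    (hg : Measurable g) (ω : Fin n → (𝒳 × I) × I) :
    ∀ᵐ z ∂testLaw P, ∃ b : Fin B, z ∈ bin B δ g ω b ∧ testLaw P (bin B δ g ω b) ≠ 0 := by
  have h : ∀ᵐ z ∂testLaw P, ∀ b : Fin B, z ∈ bin B δ g ω b → testLaw P (bin B δ g ω b) ≠ 0 := by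
    rw [ae_all_iff]
    intro b
    by_cases h : testLaw P (bin B δ g ω b) = 0
    · filter_upwards [compl_mem_ae_iff.2 h] with z hz hz'
      exact absurd hz' hz
    · exact ae_of_all _ fun _ _ => h
  filter_upwards [ae_mem_bin hB hδ hg ω, h] with z ⟨b, hb⟩ hz
  exact ⟨b, hb, hz b hb⟩

theorem measurableSet_mem_bin {g : 𝒳 → I} (hg : Measurable g) (b : ℕ) :
    MeasurableSet {x : (Fin n → (𝒳 × I) × I) × ((𝒳 × I) × I) | x.2 ∈ bin B δ g x.1 b} := by
  have h : Measurable fun x : (Fin n → (𝒳 × I) × I) × ((𝒳 × I) × I) =>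
      ((binBoundary B δ g x.1 b, binBoundary B δ g x.1 (b + 1)), x.2) :=
    (((measurable_binBoundary hg b).comp measurable_fst).prodMk
      ((measurable_binBoundary hg (b + 1)).comp measurable_fst)).prodMk measurable_snd
  exact (measurableSet_prod_Ico (measurable_testScore hg)).preimage h

/-- The deterministic core of both calibration claims: with distinct bin values, a miscalibrated
point in a bin of positive mass forces the sample mean of that bin to deviate. -/
theorem abs_condMean_sub_le {P : Measure (𝒳 × I)} [IsProbabilityMeasure P] {g : 𝒳 → I}
    (hB : 1 ≤ B) (hδ : 0 < δ) (hg : Measurable g) {τ : (Fin n → 𝒳 × I) × Seed n B}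
    (hτ : Function.Injective (binValue B δ g τ)) {b : Fin B} {z : (𝒳 × I) × I}
    (hz : z ∈ bin B δ g (joinNoise τ) b) (hb : testLaw P (bin B δ g (joinNoise τ) b) ≠ 0) {ε : ℝ}
    (hdev : joinNoise τ ∉ deviationSet P B δ g ε b) :
    |condMean P (umd B δ g τ.1 τ.2) (prediction (umd B δ g τ.1 τ.2) z) -
      prediction (umd B δ g τ.1 τ.2) z| ≤ ε + δ := by
  rw [prediction_umd_of_mem hδ τ b z hz, condMean_umd hB hδ hg hτ hb]
  have h : |binAvg B δ g (joinNoise τ) b - binTarget P B δ g (joinNoise τ) b| < ε := not_le.1 hdev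
  linarith [abs_target_sub_value_le (P := P) (g := g) hδ τ b]

/-- Only the bin hit by the test point matters. The event that bin `b` is hit and deviates has
probability at most `α` times the bound on its expected mass, and these bounds sum to `1`. -/
theorem marginallyCalibrated_umd (hB : 1 ≤ B) (hn : 2 * B ≤ n) (hδ : 0 < δ) {ε α : ℝ}
    (hε : 0 ≤ ε) (hexp : ∀ b : Fin B, 2 * Real.exp (-2 * binCount n B b * ε ^ 2) ≤ α) :
    MarginallyCalibrated (𝒳 := 𝒳) (n := n) (seedLaw n B) (umd B δ) (ε + δ) α := by
  intro g hg P _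
  set E : Fin B → Set (((Fin n → 𝒳 × I) × Seed n B) × ((𝒳 × I) × I)) := fun b =>
    {x | joinNoise x.1 ∈ deviationSet P B δ g ε b ∧ x.2 ∈ bin B δ g (joinNoise x.1) b} with hE
  have hjoin : Measurable fun x : ((Fin n → 𝒳 × I) × Seed n B) × ((𝒳 × I) × I) =>
      (joinNoise x.1, x.2) := (measurable_joinNoise.comp measurable_fst).prodMk measurable_snd
  have hdevm := fun b : Fin B => measurableSet_deviationSet (n := n) (P := P) (B := B) (δ := δ)
    hg ε b
  have hmE : ∀ b, MeasurableSet (E b) := fun b =>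
    ((hdevm b).preimage (measurable_joinNoise.comp measurable_fst)).inter
      ((measurableSet_mem_bin hg b).preimage hjoin)
  have hcov : ∀ᵐ x ∂(trainLaw n P (seedLaw n B)).prod (testLaw P), ∃ b : Fin B,
      x.2 ∈ bin B δ g (joinNoise x.1) b ∧ testLaw P (bin B δ g (joinNoise x.1) b) ≠ 0 := by
    refine (Measure.ae_prod_iff_ae_ae ?_).2
      (ae_of_all _ fun τ => ae_mem_bin_and_ne_zero hB hδ hg (joinNoise τ))
    have : {x : ((Fin n → 𝒳 × I) × Seed n B) × ((𝒳 × I) × I) | ∃ b : Fin B,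
        x.2 ∈ bin B δ g (joinNoise x.1) b ∧ testLaw P (bin B δ g (joinNoise x.1) b) ≠ 0} =
        ⋃ b : Fin B, {x | x.2 ∈ bin B δ g (joinNoise x.1) b} ∩
          {x | testLaw P (bin B δ g (joinNoise x.1) b) ≠ 0} := by
      ext x; simp
    rw [this]
    refine MeasurableSet.iUnion fun b => ((measurableSet_mem_bin hg b).preimage hjoin).inter ?_
    exact (((measurable_binMass hg b).comp measurable_joinNoise).comp measurable_fst
      (measurableSet_singleton (0 : ENNReal))).compl
  have hinj : ∀ᵐ x ∂(trainLaw n P (seedLaw n B)).prod (testLaw P),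
      Function.Injective (binValue B δ g x.1) :=
    Measure.quasiMeasurePreserving_fst.ae (ae_injective_binValue hδ hg)
  have hEb : ∀ b, ((trainLaw n P (seedLaw n B)).prod (testLaw P)) (E b) ≤
      ENNReal.ofReal α *
        (((boundary n B (b + 1) - boundary n B b : ℕ) : ENNReal) / (n + 1 : ℕ)) := by
    intro b
    -- Integrating out the test point first leaves the bin mass as a weight on the deviation event.
    calc _ = ∫⁻ τ, (deviationSet P B δ g ε b).indicator
            (fun ω => testLaw P (bin B δ g ω b)) (joinNoise τ) ∂trainLaw n P (seedLaw n B) := by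
          rw [Measure.prod_apply (hmE b)]
          refine lintegral_congr fun τ => ?_
          by_cases h : joinNoise τ ∈ deviationSet P B δ g ε b
          · rw [indicator_of_mem h]
            congr 1
            ext z
            simp [hE, h]
          · rw [indicator_of_notMem h]
            simp [hE, h]
      _ = ∫⁻ ω in deviationSet P B δ g ε b, testLaw P (bin B δ g ω b)
            ∂(Measure.pi fun _ : Fin n => testLaw P) := by
          rw [(measurePreserving_joinNoise P).lintegral_comp
            ((measurable_binMass hg b).indicator (hdevm b)), lintegral_indicator (hdevm b)]
      _ ≤ ENNReal.ofReal (2 * Real.exp (-2 * binCount n B b * ε ^ 2)) *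
            ∫⁻ ω, testLaw P (bin B δ g ω b) ∂(Measure.pi fun _ : Fin n => testLaw P) :=
          setLIntegral_deviationSet_le hB hn hδ hg
            (w := fun q => testLaw P {z | testScore δ g z ∈ Ico q.1 q.2})
            (measurable_measure_Ico (measurable_testScore hg)) hε b
      _ ≤ _ := mul_le_mul' (ENNReal.ofReal_le_ofReal (hexp b)) (lintegral_binMass_le hδ hg b)
  calc _ ≤ ((trainLaw n P (seedLaw n B)).prod (testLaw P)) (⋃ b, E b) := by
        refine measure_mono_ae ?_
        filter_upwards [hcov, hinj] with x ⟨b, hz, hb⟩ hτ hx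
        refine mem_iUnion.2 ⟨b, by_contra fun hnot => hx ?_⟩
        exact abs_condMean_sub_le hB hδ hg hτ hz hb fun hd => hnot ⟨hd, hz⟩
    _ ≤ ∑ b, ((trainLaw n P (seedLaw n B)).prod (testLaw P)) (E b) := measure_iUnion_fintype_le _ _
    _ ≤ ∑ b : Fin B, ENNReal.ofReal α *
        (((boundary n B (b + 1) - boundary n B b : ℕ) : ENNReal) / (n + 1 : ℕ)) :=
      Finset.sum_le_sum fun b _ => hEb b
    _ = _ := by rw [← Finset.mul_sum, sum_boundary_sub hB, mul_one]

theorem conditionallyCalibrated_umd (hB : 1 ≤ B) (hn : 2 * B ≤ n) (hδ : 0 < δ) {ε α : ℝ}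
    (hε : 0 ≤ ε) (hexp : ∀ b : Fin B, 2 * Real.exp (-2 * binCount n B b * ε ^ 2) ≤ α / B) :
    ConditionallyCalibrated (𝒳 := 𝒳) (n := n) (seedLaw n B) (umd B δ) (ε + δ) α := by
  intro g hg P _
  have hdevm := fun b : Fin B => measurableSet_deviationSet (n := n) (P := P) (B := B) (δ := δ)
    hg ε b
  have hEb : ∀ b : Fin B, trainLaw n P (seedLaw n B) (joinNoise ⁻¹' deviationSet P B δ g ε b) ≤
      ENNReal.ofReal (α / B) := by
    intro b
    rw [(measurePreserving_joinNoise P).measure_preimage (hdevm b).nullMeasurableSet]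
    have := setLIntegral_deviationSet_le (P := P) hB hn hδ hg (w := fun _ => 1) measurable_const
      hε b
    simp only [lintegral_const, Measure.restrict_apply_univ, one_mul, measure_univ,
      mul_one] at this
    exact this.trans (ENNReal.ofReal_le_ofReal (hexp b))
  calc _ ≤ trainLaw n P (seedLaw n B) (⋃ b : Fin B, joinNoise ⁻¹' deviationSet P B δ g ε b) := by
        refine measure_mono_ae ?_
        filter_upwards [ae_injective_binValue (P := P) hδ hg] with τ hτ hx
        by_contra hnot
        apply hx
        have hm : MeasurableSet {r | |condMean P (umd B δ g τ.1 τ.2) r - r| ≤ ε + δ} :=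
          measurableSet_le (continuous_abs.measurable.comp
            ((measurable_condMean P _).sub measurable_id)) measurable_const
        refine (ae_map_iff (measurable_prediction (measurable_umd hg _ _)).aemeasurable hm).2 ?_
        filter_upwards [ae_mem_bin_and_ne_zero (P := P) hB hδ hg (joinNoise τ)]
          with z ⟨b, hz, hb⟩
        exact abs_condMean_sub_le hB hδ hg hτ hz hb fun hd => hnot (mem_iUnion.2 ⟨b, hd⟩)
    _ ≤ ∑ b : Fin B, trainLaw n P (seedLaw n B) (joinNoise ⁻¹' deviationSet P B δ g ε b) :=
      measure_iUnion_fintype_le _ _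
    _ ≤ ∑ b : Fin B, ENNReal.ofReal (α / B) := Finset.sum_le_sum fun b _ => hEb b
    _ = _ := by
      have : (B : ℝ) ≠ 0 := by positivity
      rw [Finset.sum_const, Finset.card_univ, Fintype.card_fin, nsmul_eq_mul,
        ← ENNReal.ofReal_natCast, ← ENNReal.ofReal_mul (by positivity), mul_div_cancel₀ _ this]

/-! ### Expected calibration error in expectation -/

variable {P : Measure (𝒳 × I)} [IsProbabilityMeasure P] {g : 𝒳 → I}

/-- The mean square error of the mean labels of the bins. -/
def sqError (P : Measure (𝒳 × I)) (B : ℕ) (δ : ℝ) (g : 𝒳 → I) (ω : Fin n → (𝒳 × I) × I) : ℝ :=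
  ∑ b : Fin B, (testLaw P).real (bin B δ g ω b) *
    |binAvg B δ g ω b - binTarget P B δ g ω b| ^ 2

/-- Besides the estimate, this finite formula gives the almost everywhere measurability of the error
in the training variables. -/
theorem ece_umd_eq (hB : 1 ≤ B) (hδ : 0 < δ) (hg : Measurable g)
    {τ : (Fin n → 𝒳 × I) × Seed n B} (hτ : Function.Injective (binValue B δ g τ)) (p : ℝ) :
    ece P (umd B δ g τ.1 τ.2) p =
      (∑ b : Fin B, (testLaw P).real (bin B δ g (joinNoise τ) b) *
        |binTarget P B δ g (joinNoise τ) b - binValue B δ g τ b| ^ p) ^ (1 / p) := by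
  rw [ece, integral_of_partition (A := fun b : Fin B => bin B δ g (joinNoise τ) b)
    (fun b => measurableSet_bin hg _ b) (pairwise_disjoint_bin hδ _) (ae_mem_bin hB hδ hg _)]
  intro b hb z hz
  rw [prediction_umd_of_mem hδ τ b z hz, condMean_umd hB hδ hg hτ hb]

theorem ece_umd_le (hB : 1 ≤ B) (hδ : 0 < δ) (hg : Measurable g)
    {τ : (Fin n → 𝒳 × I) × Seed n B} (hτ : Function.Injective (binValue B δ g τ)) {p : ℝ}
    (hp : 1 ≤ p) (hp2 : p ≤ 2) :
    ece P (umd B δ g τ.1 τ.2) p ≤ √(sqError P B δ g (joinNoise τ)) + δ := by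
  rw [ece_umd_eq hB hδ hg hτ]
  exact weighted_rpow_le_sqrt_add hδ.le (fun b => measureReal_nonneg)
    (sum_measureReal_of_partition (A := fun b : Fin B => bin B δ g (joinNoise τ) b)
      (fun b => measurableSet_bin hg _ b) (pairwise_disjoint_bin hδ _) (ae_mem_bin hB hδ hg _))
    (fun b => abs_nonneg _) (abs_target_sub_value_le hδ τ) (fun b => abs_nonneg _) hp hp2

theorem measurable_sqError (hg : Measurable g) :
    Measurable (sqError (n := n) P B δ g) := by
  unfold sqError
  refine Finset.measurable_sum _ fun b _ => (measurable_binMass hg b).ennreal_toReal.mul ?_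
  exact (continuous_abs.measurable.comp
    ((measurable_binAvg hg b).sub (measurable_binTarget hg b))).pow_const 2

theorem sqError_nonneg {P : Measure (𝒳 × I)} (ω : Fin n → (𝒳 × I) × I) : 0 ≤ sqError P B δ g ω :=
  Finset.sum_nonneg fun _ _ => mul_nonneg measureReal_nonneg (sq_nonneg _)

theorem lintegral_sqError_le (hB : 1 ≤ B) (hn : 2 * B ≤ n) (hδ : 0 < δ) (hg : Measurable g) :
    ∫⁻ ω, ENNReal.ofReal (sqError P B δ g ω) ∂(Measure.pi fun _ : Fin n => testLaw P) ≤
      ENNReal.ofReal (B / (2 * n)) := by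
  have e : ∀ ω : Fin n → (𝒳 × I) × I, ENNReal.ofReal (sqError P B δ g ω) =
      ∑ b : Fin B, testLaw P (bin B δ g ω b) *
        ENNReal.ofReal ((binAvg B δ g ω b - binTarget P B δ g ω b) ^ 2) := by
    intro ω
    rw [sqError, ENNReal.ofReal_sum_of_nonneg fun _ _ =>
      mul_nonneg measureReal_nonneg (sq_nonneg _)]
    refine Finset.sum_congr rfl fun b _ => ?_
    rw [ENNReal.ofReal_mul measureReal_nonneg, ofReal_measureReal, sq_abs]
  have hm : ∀ b : Fin B, Measurable fun ω : Fin n → (𝒳 × I) × I => testLaw P (bin B δ g ω b) *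
      ENNReal.ofReal ((binAvg B δ g ω b - binTarget P B δ g ω b) ^ 2) := fun b =>
    (measurable_binMass hg b).mul
      (((measurable_binAvg hg b).sub (measurable_binTarget hg b)).pow_const 2).ennreal_ofReal
  simp_rw [e]
  rw [lintegral_finsetSum _ fun b _ => hm b]
  calc _ ≤ ∑ b : Fin B, ENNReal.ofReal (1 / (2 * n)) :=
        Finset.sum_le_sum fun b _ => lintegral_sq_error_bin_le hB hn hδ hg b
    _ = _ := by
      rw [Finset.sum_const, Finset.card_univ, Fintype.card_fin, nsmul_eq_mul,
        ← ENNReal.ofReal_natCast, ← ENNReal.ofReal_mul (by positivity), mul_one_div]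

theorem integrable_sqError_and_integral_le (hB : 1 ≤ B) (hn : 2 * B ≤ n) (hδ : 0 < δ)
    (hg : Measurable g) :
    Integrable (fun τ => sqError P B δ g (joinNoise τ)) (trainLaw n P (seedLaw n B)) ∧
      ∫ τ, sqError P B δ g (joinNoise τ) ∂trainLaw n P (seedLaw n B) ≤ B / (2 * n) := by
  have hm : Measurable fun τ : (Fin n → 𝒳 × I) × Seed n B => sqError P B δ g (joinNoise τ) :=
    (measurable_sqError hg).comp measurable_joinNoise
  have h : ∫⁻ τ, ENNReal.ofReal (sqError P B δ g (joinNoise τ)) ∂trainLaw n P (seedLaw n B) ≤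
      ENNReal.ofReal (B / (2 * n)) := by
    rw [(measurePreserving_joinNoise P).lintegral_comp (measurable_sqError hg).ennreal_ofReal]
    exact lintegral_sqError_le hB hn hδ hg
  refine ⟨⟨hm.aestronglyMeasurable, ?_⟩, ?_⟩
  · rw [hasFiniteIntegral_iff_ofReal (ae_of_all _ fun τ => sqError_nonneg _)]
    exact h.trans_lt ENNReal.ofReal_lt_top
  · rw [integral_eq_lintegral_of_nonneg_ae (ae_of_all _ fun τ => sqError_nonneg _)
      hm.aestronglyMeasurable]
    exact ENNReal.toReal_le_of_le_ofReal (by positivity) h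

theorem integrable_ece_and_integral_le (hB : 1 ≤ B) (hn : 2 * B ≤ n) (hδ : 0 < δ)
    (hg : Measurable g) {p : ℝ} (hp : 1 ≤ p) (hp2 : p ≤ 2) :
    Integrable (fun τ => ece P (umd B δ g τ.1 τ.2) p) (trainLaw n P (seedLaw n B)) ∧
      ∫ τ, ece P (umd B δ g τ.1 τ.2) p ∂trainLaw n P (seedLaw n B) ≤
        √((B : ℝ) / (2 * (n : ℝ))) + δ := by
  obtain ⟨hint, hle⟩ := integrable_sqError_and_integral_le (P := P) hB hn hδ hg
  have hn0 : 0 < n := by omega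
  set c := √((B : ℝ) / (2 * (n : ℝ))) with hc
  have hc0 : 0 < c := Real.sqrt_pos.2 (by positivity)
  have hc2 : c ^ 2 = (B : ℝ) / (2 * (n : ℝ)) := Real.sq_sqrt (by positivity)
  -- Tangent line of the square root at `c²`, the bound on the mean of `sqError`. It replaces Jensen
  -- and also yields an integrable majorant.
  have hsqrt : ∀ x : ℝ, 0 ≤ x → √x ≤ (2 * c)⁻¹ * x + c / 2 := by
    intro x hx
    have h := sq_nonneg (√x - c)
    rw [sub_sq, Real.sq_sqrt hx] at h
    rw [inv_mul_eq_div, div_add_div _ _ (by positivity) two_ne_zero, le_div_iff₀ (by positivity)]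
    nlinarith
  have hinj := ae_injective_binValue (n := n) (B := B) (P := P) hδ hg
  have hbound : ∀ᵐ τ ∂trainLaw n P (seedLaw n B), ece P (umd B δ g τ.1 τ.2) p ≤
      (2 * c)⁻¹ * sqError P B δ g (joinNoise τ) + (c / 2 + δ) := by
    filter_upwards [hinj] with τ hτ
    linarith [ece_umd_le (P := P) hB hδ hg hτ hp hp2,
      hsqrt _ (sqError_nonneg (P := P) (B := B) (δ := δ) (g := g) (joinNoise τ))]
  have hdom : Integrable (fun τ => (2 * c)⁻¹ * sqError P B δ g (joinNoise τ) + (c / 2 + δ))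
      (trainLaw n P (seedLaw n B)) := (hint.const_mul _).add (integrable_const _)
  have hmeas : AEStronglyMeasurable (fun τ => ece P (umd B δ g τ.1 τ.2) p)
      (trainLaw n P (seedLaw n B)) := by
    have hm : Measurable fun τ : (Fin n → 𝒳 × I) × Seed n B =>
        (∑ b : Fin B, (testLaw P).real (bin B δ g (joinNoise τ) b) *
          |binTarget P B δ g (joinNoise τ) b - binValue B δ g τ b| ^ p) ^ (1 / p) := by
      refine Measurable.pow_const (Finset.measurable_sum _ fun b _ => ?_) _
      refine ((measurable_binMass hg b).comp measurable_joinNoise).ennreal_toReal.mul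
        (Measurable.pow_const ?_ _)
      exact continuous_abs.measurable.comp (((measurable_binTarget hg b).comp
        measurable_joinNoise).sub (measurable_binValue hg b))
    refine ⟨_, hm.stronglyMeasurable, ?_⟩
    filter_upwards [hinj] with τ hτ
    exact ece_umd_eq hB hδ hg hτ p
  have hece : Integrable (fun τ => ece P (umd B δ g τ.1 τ.2) p) (trainLaw n P (seedLaw n B)) := by
    refine hdom.mono' hmeas ?_
    filter_upwards [hbound] with τ hτ
    rw [Real.norm_of_nonneg]
    · exact hτ
    · exact Real.rpow_nonneg (integral_nonneg fun _ => Real.rpow_nonneg (abs_nonneg _) _) _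
  refine ⟨hece, ?_⟩
  calc _ ≤ ∫ τ, ((2 * c)⁻¹ * sqError P B δ g (joinNoise τ) + (c / 2 + δ))
        ∂trainLaw n P (seedLaw n B) := integral_mono_ae hece hdom hbound
    _ = (2 * c)⁻¹ * ∫ τ, sqError P B δ g (joinNoise τ) ∂trainLaw n P (seedLaw n B) +
        (c / 2 + δ) := by
      rw [integral_add (hint.const_mul _) (integrable_const _), integral_const_mul]
      simp
    _ ≤ (2 * c)⁻¹ * c ^ 2 + (c / 2 + δ) := by rw [hc2]; gcongr
    _ = c + δ := by field_simp; ring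

end Calibrated

end RandomizedUMD

end

theorem theorem2 {𝒳 : Type*} [MeasurableSpace 𝒳] (n B : ℕ) (hB : 1 ≤ B) (hn : 2 * B ≤ n)
    (δ : ℝ) (hδ : 0 < δ) :
    (∀ α : ℝ, 0 < α → α < 1 → ∀ ε₁ ε₂ : ℝ,
      ε₁ = √(Real.log (2 / α) / (2 * ((⌊(n : ℝ) / (B : ℝ)⌋₊ : ℝ) - 1))) + δ →
      ε₂ = √(Real.log (2 * (B : ℝ) / α) / (2 * ((⌊(n : ℝ) / (B : ℝ)⌋₊ : ℝ) - 1))) + δ →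
      RandomizedUMD.MarginallyCalibrated (𝒳 := 𝒳) (n := n)
          (RandomizedUMD.seedLaw n B) (RandomizedUMD.umd B δ) ε₁ α ∧
      RandomizedUMD.ConditionallyCalibrated (𝒳 := 𝒳) (n := n)
          (RandomizedUMD.seedLaw n B) (RandomizedUMD.umd B δ) ε₂ α ∧
      ∀ g : 𝒳 → I, Measurable g → ∀ (P : Measure (𝒳 × I)) [IsProbabilityMeasure P],
        RandomizedUMD.trainLaw n P (RandomizedUMD.seedLaw n B)
          {τ | ∀ p : ℝ, 1 ≤ p →
            RandomizedUMD.ece P (RandomizedUMD.umd B δ g τ.1 τ.2) p ≤ ε₂}ᶜ ≤ ENNReal.ofReal α) ∧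
    ∀ g : 𝒳 → I, Measurable g → ∀ (P : Measure (𝒳 × I)) [IsProbabilityMeasure P],
      ∀ p : ℝ, 1 ≤ p → p ≤ 2 →
        Integrable (fun τ => RandomizedUMD.ece P (RandomizedUMD.umd B δ g τ.1 τ.2) p)
          (RandomizedUMD.trainLaw n P (RandomizedUMD.seedLaw n B)) ∧
        ∫ τ, RandomizedUMD.ece P (RandomizedUMD.umd B δ g τ.1 τ.2) p
          ∂(RandomizedUMD.trainLaw n P (RandomizedUMD.seedLaw n B))
          ≤ √((B : ℝ) / (2 * (n : ℝ))) + δ := by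
  refine ⟨fun α hα hα1 ε₁ ε₂ h₁ h₂ => ?_, fun g hg P _ p hp hp2 =>
    RandomizedUMD.integrable_ece_and_integral_le hB hn hδ hg hp hp2⟩
  subst h₁ h₂
  have hB' : (1 : ℝ) ≤ B := by exact_mod_cast hB
  have hcond := RandomizedUMD.conditionallyCalibrated_umd (𝒳 := 𝒳) hB hn hδ (α := α)
    (Real.sqrt_nonneg _)
    fun b => RandomizedUMD.two_mul_exp_le hB hn hα hα1 hB' b
  refine ⟨RandomizedUMD.marginallyCalibrated_umd hB hn hδ (Real.sqrt_nonneg _) fun b => ?_, hcond,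
    -- The ECE bounds for all `p` hold on the single event of conditional calibration.
    fun g hg P _ => (measure_mono (compl_subset_compl.2 fun τ hτ p hp => ?_)).trans (hcond g hg P)⟩
  · simpa using RandomizedUMD.two_mul_exp_le hB hn hα hα1 le_rfl b
  · exact RandomizedUMD.UniformlyCalibrated.ece_le (RandomizedUMD.measurable_umd hg _ _)
      (by positivity) hτ hp
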